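/- For a binary word $x=e_te_{t-1}\cdots e_2$ put $[x]=\sum_{i=2}^{t}e_iF_i$, where $F_i$ are the Fibonacci numbers ($F_0=0$, $F_1=1$); $x$ is a valid Fibonacci (Zeckendorf) representation if it has no factor $11$ (leading zeros are allowed). Automata are deterministic, with a partial transition function, and read words most significant digit first; minimality is meant among such automata, so that no dead state is counted. Let $M_{\mathrm{add}}$ be the addition automaton, which accepts $x\times y\times z$, with $x,y,z$ valid words of the same length, iff $[x]+[y]=[z]$; its states are the reachable, non-dead ones of the automaton that on $x\times y\times z$ keeps track of the sequence $([x0^n]+[y0^n]-[z0^n])_{n\ge 0}$ and of the last letters of $x,y,z$. For $c\ge 0$ construct an automaton $M_{=c}$ recursively. $M_{=0}$ is the one-state automaton accepting $0^*$. If $c>0$ is even, $M_{=c}$ is obtained from $M_{=c/2}$ by translating $\exists y\; M_{=c/2}(y)\wedge M_{\mathrm{add}}(y,y,x)$; if $c$ is odd, $M_{=c}$ is obtained from $M_{=c-1}$ by translating $\exists y\; M_{=c-1}(y)\wedge M_{\mathrm{add}}(y,1,x)$, where the constant $1$ is given by the two-state automaton accepting $0^*1$. A translation consists of the product construction (reachable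 part), the projection onto the track of $x$, the subset construction (reachable part), and minimization, that is, removal of dead states followed by Hopcroft's partition refinement and merging of equivalent states. Time is measured by the number of states and transitions that are written down or traversed in all these steps, including all levels of the recursion. Then for every $c\ge 0$ this construction has a complete run, and every complete run of it, whatever the order in which the pending splitters are processed in the partition refinement, yields a minimal automaton recognizing $\{x : x \text{ a valid Fibonacci representation},\ [x]=c\}$ and takes $O((\log^2 c)(\log\log c))$ time, with one absolute implied constant. (For $c\ge 3$ the bound is meant literally; for $c\le 2$ it is read as $O(1)$.) -/

import Mathlib

/-! ## Fibonacci (Zeckendorf) representation, most significant digit first -/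

/-- The value `[x]` of a binary word `x = e_t ⋯ e_2`, namely `∑ e_i F_i`: the last letter has weight
`F_2`, and the first letter of a word `b :: w` has weight `F_{|w| + 2}`. -/
def fibVal : List Bool → ℕ
  | [] => 0
  | b :: w => (if b then Nat.fib (w.length + 2) else 0) + fibVal w

/-- A word is a valid Fibonacci representation (leading zeros allowed) if it has no factor `11`. -/
def ValidFib (x : List Bool) : Prop :=
  List.IsChain (fun a b => ¬ (a = true ∧ b = true)) x

/-! ## Deterministic automata with a partial transition function -/

/-- A deterministic automaton whose transition function may be partial.
Every automaton used below has finitely many states; see the instances. -/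
structure PDFA (α : Type) where
  State : Type
  start : State
  step : State → α → Option State
  accept : Set State

namespace PDFA

variable {α β : Type}

/-- The extended transition function. -/
def run (A : PDFA α) : A.State → List α → Option A.State
  | s, [] => some s
  | s, a :: w => (A.step s a).bind fun t => A.run t w

/-- The language recognized by the automaton. -/
def language (A : PDFA α) : Set (List α) :=
  {w | ∃ q ∈ A.accept, A.run A.start w = some q}

/-- A state is accessible if it is reachable from the start state. -/
def IsAccessible (A : PDFA α) (s : A.State) : Prop :=
  ∃ w, A.run A.start w = some s

/-- A state is co-accessible (not dead) if an accepting state is reachable from it. -/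
def IsCoaccessible (A : PDFA α) (s : A.State) : Prop :=
  ∃ w, ∃ q ∈ A.accept, A.run s w = some q

/-- The defined transitions of the automaton, each given by its source and its letter. -/
def transitions (A : PDFA α) : Set (A.State × α) :=
  {p | ∃ t, A.step p.1 p.2 = some t}

/-- The number of states plus the number of transitions: the time for writing down the automaton,
or for one traversal of it. -/
noncomputable def size (A : PDFA α) : ℕ :=
  Nat.card A.State + A.transitions.ncard

/-- `A` is a minimal automaton (dead states being left out): it is finite, and no finite
automaton with a partial transition function for the same language has fewer states. -/
def IsMinimal (A : PDFA α) : Prop :=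
  Finite A.State ∧
    ∀ B : PDFA α, Finite B.State → B.language = A.language →
      Nat.card A.State ≤ Nat.card B.State

/-- Remove the states that do not satisfy `P`. -/
noncomputable def restrict (A : PDFA α) (P : A.State → Prop) (h : P A.start) : PDFA α := by
  classical exact
  { State := {s // P s}
    start := ⟨A.start, h⟩
    step := fun s a =>
      (A.step s.1 a).bind fun t => if ht : P t then some ⟨t, ht⟩ else none
    accept := {s | s.1 ∈ A.accept} }

/-- Keep only the accessible states. -/
noncomputable def accessible (A : PDFA α) : PDFA α :=
  A.restrict A.IsAccessible ⟨[], rfl⟩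

/-- Remove the dead states (keeping the start state in any case). -/
noncomputable def trim (A : PDFA α) : PDFA α :=
  A.restrict (fun s => A.IsCoaccessible s ∨ s = A.start) (Or.inr rfl)

/-- Let `A` read the letters of another alphabet through `f`. With `f` a choice of tracks, this is
the substitution of variables in `A(x, y, …)`. -/
def comap (f : β → α) (A : PDFA α) : PDFA β where
  State := A.State
  start := A.start
  step := fun s b => A.step s (f b)
  accept := A.accept

/-- The full product automaton of `A` and `B`. -/
def prod (A B : PDFA α) : PDFA α where
  State := A.State × B.State
  start := (A.start, B.start)
  step := fun s a =>
    (A.step s.1 a).bind fun p => (B.step s.2 a).map fun q => (p, q)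
  accept := {s | s.1 ∈ A.accept ∧ s.2 ∈ B.accept}

/-- Conjunction: the product construction, exploring only what is reachable from the start. -/
noncomputable def inter (A B : PDFA α) : PDFA α :=
  (A.prod B).accessible

/-- Existential quantification: only the part `f a` of each letter `a` is kept on the transitions.
The result is nondeterministic in general. -/
def project (A : PDFA α) (f : α → β) : NFA β A.State where
  step := fun s b => {t | ∃ a, f a = b ∧ A.step s a = some t}
  start := {A.start}
  accept := A.accept

end PDFA

/-! ## Subset construction -/

namespace NFA

variable {α σ : Type}

/-- The deterministic automaton on all sets of states; the empty set counts as undefined. -/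
noncomputable def powerset (N : NFA α σ) : PDFA α := by
  classical exact
  { State := Set σ
    start := N.start
    step := fun S a => if (N.stepSet S a).Nonempty then some (N.stepSet S a) else none
    accept := {S | ∃ s ∈ S, s ∈ N.accept} }

/-- The subset construction, exploring only the sets that are reachable from the start. -/
noncomputable def determinize (N : NFA α σ) : PDFA α :=
  N.powerset.accessible

/-- The cost of the subset construction: for every reachable set `S` and every letter `a`, all
transitions `s → t` on `a` with `s ∈ S` are traversed; the resulting automaton is written down. -/
noncomputable def determinizeCost (N : NFA α σ) : ℕ :=
  {p : N.determinize.State × σ × α × σ |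
      p.2.1 ∈ (show Set σ from p.1.1) ∧ p.2.2.2 ∈ N.step p.2.1 p.2.2.1}.ncard
    + N.determinize.size

end NFA

/-! ## Minimization by partition refinement, processing the smaller half -/

namespace PDFA

variable {α : Type}

/-- The states with a transition on `a` into `C`. -/
def preimage (A : PDFA α) (C : Set A.State) (a : α) : Set A.State :=
  {s | ∃ t ∈ C, A.step s a = some t}

/-- The data of Hopcroft's algorithm: the current partition of the states, and the splitters
(block, letter) that are still to be processed. -/
structure Refinement (A : PDFA α) where
  blocks : Set (Set A.State)
  work : Set (Set A.State × α)

/-- The partition into accepting and other states; all splitters are pending. -/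
def initialRefinement (A : PDFA α) : A.Refinement where
  blocks := {B | B.Nonempty ∧ (B = A.accept ∨ B = A.acceptᶜ)}
  work := {p | p.1.Nonempty ∧ (p.1 = A.accept ∨ p.1 = A.acceptᶜ)}

/-- `X` splits `B` if it contains some elements of `B`, but not all of them. -/
def Splits {σ : Type} (X B : Set σ) : Prop :=
  (B ∩ X).Nonempty ∧ (B \ X).Nonempty

/-- The smaller one of the two parts into which `X` splits `B`. -/
noncomputable def smallerPart {σ : Type} (X B : Set σ) : Set σ := by
  classical exact if (B ∩ X).ncard ≤ (B \ X).ncard then B ∩ X else B \ X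

/-- Processing the splitter `(C, a)`: with `X` the set of states that `a` takes into `C`, every
block `B` split by `X` is replaced by `B ∩ X` and `B \ X`. A pending splitter `(B, b)` is then
replaced by both parts; if `(B, b)` is not pending, only the smaller part becomes pending. -/
def Refinement.process {A : PDFA α} (R : A.Refinement) (C : Set A.State) (a : α) :
    A.Refinement where
  blocks := {D | ∃ B ∈ R.blocks,
    (¬ Splits (A.preimage C a) B ∧ D = B) ∨
    (Splits (A.preimage C a) B ∧ (D = B ∩ A.preimage C a ∨ D = B \ A.preimage C a))}
  work := {p | ∃ B ∈ R.blocks,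
    (¬ Splits (A.preimage C a) B ∧ p.1 = B ∧ (B, p.2) ∈ R.work \ {(C, a)}) ∨
    (Splits (A.preimage C a) B ∧
      (p.1 = B ∩ A.preimage C a ∨ p.1 = B \ A.preimage C a) ∧
      ((B, p.2) ∈ R.work \ {(C, a)} ∨ p.1 = smallerPart (A.preimage C a) B))}

/-- `R.RefinesTo P t`: from `R`, some run of the algorithm (the pending splitters being chosen in
any order) ends with the partition `P`, at cost `t`. Processing `(C, a)` costs the number of states
in `C` plus the number of transitions on `a` into `C`, which are traversed backwards. -/
inductive Refinement.RefinesTo {A : PDFA α} : A.Refinement → Set (Set A.State) → ℕ → Prop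
  | done (P : Set (Set A.State)) : Refinement.RefinesTo ⟨P, ∅⟩ P 0
  | process (R : A.Refinement) (C : Set A.State) (a : α) (P : Set (Set A.State)) (t : ℕ) :
      (C, a) ∈ R.work → Refinement.RefinesTo (R.process C a) P t →
      Refinement.RefinesTo R P (C.ncard + (A.preimage C a).ncard + t)

/-- Lying in the same blocks of `P`. -/
def sameBlock (A : PDFA α) (P : Set (Set A.State)) : Setoid A.State where
  r := fun s t => ∀ B ∈ P, s ∈ B ↔ t ∈ B
  iseqv := ⟨fun _ _ _ => Iff.rfl, fun h B hB => (h B hB).symm,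
    fun h k B hB => (h B hB).trans (k B hB)⟩

/-- Merge the states in each block of `P`, reading off the transitions from a representative. -/
noncomputable def merge (A : PDFA α) (P : Set (Set A.State)) : PDFA α where
  State := Quotient (A.sameBlock P)
  start := Quotient.mk _ A.start
  step := fun q a => (A.step q.out a).map (Quotient.mk _)
  accept := {q | q.out ∈ A.accept}

/-- `D.MinimizesTo M t`: the minimization of `D` can end with `M` at cost `t`. Dead states are
removed by a traversal of `D`, then the states are partitioned, then the blocks are merged by a
traversal of the trimmed automaton. -/
inductive MinimizesTo (D : PDFA α) : PDFA α → ℕ → Prop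
  | intro (P : Set (Set D.trim.State)) (t : ℕ) :
      D.trim.initialRefinement.RefinesTo P t →
      MinimizesTo D (D.trim.merge P) (D.size + t + D.trim.size)

/-- `A.QuantifiesTo f M t`: from the automaton `A`, projecting the letters by `f`, determinizing,
and minimizing can end with `M` at cost `t`. -/
def QuantifiesTo {β : Type} (A : PDFA α) (f : α → β) (M : PDFA β) (t : ℕ) : Prop :=
  ∃ u, (A.project f).determinize.MinimizesTo M u ∧
    t = A.transitions.ncard + (A.project f).determinizeCost + u

end PDFA

/-! ## The automaton for addition -/

/-- The difference automaton for `[x] + [y] = [z]`, with infinitely many states. On `x × y × z` it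
reaches `(d₀, d₁, a, b, e)`, where `d_n = [x0ⁿ] + [y0ⁿ] - [z0ⁿ]` (these two numbers determine the
whole sequence, as `d_{n+2} = d_{n+1} + d_n`), and `a`, `b`, `e` are the last letters of `x`, `y`,
`z`. Transitions that would produce a factor `11` in `x`, `y` or `z` are undefined. -/
def adderDiff : PDFA (Bool × Bool × Bool) where
  State := ℤ × ℤ × Bool × Bool × Bool
  start := (0, 0, false, false, false)
  step := fun (d₀, d₁, a', b', e') (a, b, e) =>
    if (a' && a) || (b' && b) || (e' && e) then none
    else
      let δ : ℤ := (a.toNat : ℤ) + (b.toNat : ℤ) - (e.toNat : ℤ)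
      some (d₁ + δ, d₀ + d₁ + 2 * δ, a, b, e)
  accept := {s | s.1 = 0}

/-- The addition automaton: the states of the difference automaton that are reachable and not
dead. There are only finitely many of them. -/
noncomputable def adder : PDFA (Bool × Bool × Bool) :=
  adderDiff.accessible.trim

/-! ## The recursive construction -/

/-- The automaton with one state for `[x] = 0`. -/
def zeroAut : PDFA Bool where
  State := Unit
  start := ()
  step := fun _ b => if b then none else some ()
  accept := {()}

/-- The automaton with two states for `[x] = 1`. -/
def oneAut : PDFA Bool where
  State := Bool
  start := false
  step := fun s b => if s then none else some b
  accept := {true}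

/-- The product automaton for `M(y) ∧ adder(y, y, x)`, over the letters `(y, x)`. -/
noncomputable def doubleProd (M : PDFA Bool) : PDFA (Bool × Bool) :=
  (M.comap fun l => l.1).inter (adder.comap fun l => (l.1, l.1, l.2))

/-- The product automaton for `oneAut(u) ∧ adder(y, u, x)`, over the letters `(y, u, x)`. -/
noncomputable def addOne : PDFA (Bool × Bool × Bool) :=
  (oneAut.comap fun l => l.2.1).inter adder

/-- The product automaton for `M(y) ∧ oneAut(u) ∧ adder(y, u, x)`, over the letters
`(y, u, x)`. -/
noncomputable def succProd (M : PDFA Bool) : PDFA (Bool × Bool × Bool) :=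
  (M.comap fun l => l.1).inter addOne

/-- `Builds c M t`: the recursive construction for the relation `[x] = c` can end with the
automaton `M`, at total cost `t`. For `c = 0` it writes down the automaton with one state. For even
`c > 0` it builds an automaton `M'` for `c / 2` and then translates `∃ y, M'(y) ∧ adder(y, y, x)`.
For odd `c` it builds an automaton `M'` for `c - 1` and then translates
`∃ y, M'(y) ∧ adder(y, 1, x)`. -/
inductive Builds : ℕ → PDFA Bool → ℕ → Prop
  | zero : Builds 0 zeroAut zeroAut.size
  | even (c : ℕ) (M' M : PDFA Bool) (t u : ℕ) :
      0 < c → Even c → Builds (c / 2) M' t →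
      (doubleProd M').QuantifiesTo (fun l => l.2) M u →
      Builds c M (t + (doubleProd M').size + u)
  | odd (c : ℕ) (M' M : PDFA Bool) (t u : ℕ) :
      Odd c → Builds (c - 1) M' t →
      (succProd M').QuantifiesTo (fun l => l.2.2) M u →
      Builds c M (t + addOne.size + (succProd M').size + u)

/-! ## Finiteness of the automata, so that the counts above are the true ones -/

instance PDFA.finite_restrict {α : Type} (A : PDFA α) (P : A.State → Prop) (h : P A.start)
    [Finite A.State] : Finite (A.restrict P h).State :=
  inferInstanceAs (Finite {s // P s})

instance PDFA.finite_accessible {α : Type} (A : PDFA α) [Finite A.State] :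
    Finite A.accessible.State := PDFA.finite_restrict A _ _

instance PDFA.finite_trim {α : Type} (A : PDFA α) [Finite A.State] :
    Finite A.trim.State := PDFA.finite_restrict A _ _

instance PDFA.finite_comap {α β : Type} (f : β → α) (A : PDFA α) [Finite A.State] :
    Finite (A.comap f).State := inferInstanceAs (Finite A.State)

instance PDFA.finite_inter {α : Type} (A B : PDFA α) [Finite A.State] [Finite B.State] :
    Finite (A.inter B).State :=
  haveI : Finite (A.prod B).State := inferInstanceAs (Finite (A.State × B.State))
  PDFA.finite_accessible _

instance NFA.finite_determinize {α σ : Type} (N : NFA α σ) [Finite σ] :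
    Finite N.determinize.State :=
  haveI : Finite N.powerset.State := inferInstanceAs (Finite (Set σ))
  PDFA.finite_accessible _

instance PDFA.finite_merge {α : Type} (A : PDFA α) (P : Set (Set A.State)) [Finite A.State] :
    Finite (A.merge P).State := inferInstanceAs (Finite (Quotient (A.sameBlock P)))

theorem PDFA.run_restrict {α : Type} (A : PDFA α) (P : A.State → Prop) (h : P A.start)
    (w : List α) (s t : (A.restrict P h).State) (hr : (A.restrict P h).run s w = some t) :
    A.run s.1 w = some t.1 := by
  induction w generalizing s with
  | nil =>
    simp only [PDFA.run, Option.some.injEq] at hr ⊢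
    rw [hr]
  | cons a w ih =>
    simp only [PDFA.run, Option.bind_eq_some_iff] at hr ⊢
    obtain ⟨q, hq, hw⟩ := hr
    refine ⟨q.1, ?_, ih q hw⟩
    obtain ⟨r, hr, hq⟩ := Option.bind_eq_some_iff.1
      (show (A.step s.1 a).bind _ = some q from hq)
    split_ifs at hq with hP
    rw [hr, ← Option.some.inj hq]

/-- A letter changes `d₁ - φ d₀` by a contraction that keeps `[-2, 2]` invariant. -/
theorem adderDiff_step (s t : adderDiff.State) (l : Bool × Bool × Bool)
    (hst : adderDiff.step s l = some t)
    (hs : |(s.2.1 : ℝ) - Real.goldenRatio * (s.1 : ℝ)| ≤ 2) :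
    |(t.2.1 : ℝ) - Real.goldenRatio * (t.1 : ℝ)| ≤ 2 ∧ (7 ≤ |s.1| → 7 ≤ |t.1|) := by
  have h1 : Real.goldenRatio ^ 2 = Real.goldenRatio + 1 := Real.goldenRatio_sq
  have h2 : (1.6 : ℝ) < Real.goldenRatio := by
    nlinarith [Real.one_lt_goldenRatio]
  have h3 : Real.goldenRatio < 2 := Real.goldenRatio_lt_two
  obtain ⟨x, y, a', b', e'⟩ := s
  obtain ⟨a, b, e⟩ := l
  simp only [adderDiff] at hst
  split_ifs at hst
  obtain ⟨δ, hδ⟩ : ∃ δ : ℤ, δ = (a.toNat : ℤ) + (b.toNat : ℤ) - (e.toNat : ℤ) := ⟨_, rfl⟩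
  rw [← hδ] at hst
  have hb : -2 ≤ δ ∧ δ ≤ 2 := by
    cases a <;> cases b <;> cases e <;> simp at hδ <;> omega
  have hl : (-2 : ℝ) ≤ δ := by exact_mod_cast hb.1
  have hu : (δ : ℝ) ≤ 2 := by exact_mod_cast hb.2
  have ht := Option.some.inj hst
  subst ht
  simp only at hs ⊢
  rw [abs_le] at hs
  refine ⟨?_, ?_⟩
  · push_cast
    have key : (x : ℝ) + y + 2 * δ - Real.goldenRatio * (y + δ)
        = (1 - Real.goldenRatio) * (y - Real.goldenRatio * x) + (2 - Real.goldenRatio) * δ := by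
      linear_combination (-(x : ℝ)) * h1
    rw [key, abs_le]
    constructor <;> nlinarith
  · intro h7
    rcases le_abs.1 h7 with h | h
    · apply le_abs.2
      left
      have hx : (7 : ℝ) ≤ x := by exact_mod_cast h
      have : (6 : ℝ) < y + δ := by nlinarith
      have : (6 : ℤ) < y + δ := by exact_mod_cast this
      omega
    · apply le_abs.2
      right
      have hx : (7 : ℝ) ≤ -x := by exact_mod_cast h
      have : (y : ℝ) + δ < -6 := by nlinarith
      have : y + δ < (-6 : ℤ) := by exact_mod_cast this
      omega

theorem adderDiff_run (w : List (Bool × Bool × Bool)) (s t : adderDiff.State)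
    (hst : adderDiff.run s w = some t)
    (hs : |(s.2.1 : ℝ) - Real.goldenRatio * (s.1 : ℝ)| ≤ 2) :
    |(t.2.1 : ℝ) - Real.goldenRatio * (t.1 : ℝ)| ≤ 2 ∧ (7 ≤ |s.1| → 7 ≤ |t.1|) := by
  induction w generalizing s with
  | nil =>
    simp only [PDFA.run, Option.some.injEq] at hst
    subst hst
    exact ⟨hs, id⟩
  | cons a w ih =>
    simp only [PDFA.run, Option.bind_eq_some_iff] at hst
    obtain ⟨q, hq, hw⟩ := hst
    obtain ⟨h1, h2⟩ := adderDiff_step s q a hq hs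
    obtain ⟨h3, h4⟩ := ih q hw h1
    exact ⟨h3, fun h => h4 (h2 h)⟩

instance finite_adder : Finite adder.State := by
  let T : Set (ℤ × ℤ × Bool × Bool × Bool) :=
    Set.Icc (-6) 6 ×ˢ (Set.Icc (-20) 20 ×ˢ Set.univ)
  have hT : T.Finite :=
    (Set.finite_Icc _ _).prod ((Set.finite_Icc _ _).prod Set.finite_univ)
  have key : ∀ s : adder.State, (show ℤ × ℤ × Bool × Bool × Bool from s.1.1) ∈ T := by
    rintro ⟨⟨s, w, hw⟩, hs⟩
    have h0 := (adderDiff_run w adderDiff.start s hw (by simp [adderDiff])).1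
    have h6 : |s.1| < 7 := by
      rcases hs with ⟨v, q, hq, hv⟩ | hs
      · have hrun := PDFA.run_restrict _ _ _ _ _ _ hv
        have h1 := (adderDiff_run v s q.1 hrun h0).2
        have h2 : q.1.1 = 0 := hq
        by_contra h
        have h3 := h1 (not_lt.1 h)
        rw [h2] at h3
        norm_num at h3
      · have h2 : s = adderDiff.start := congrArg Subtype.val hs
        rw [h2]
        simp [adderDiff]
    have hg := Real.goldenRatio_lt_two
    have hg0 := Real.one_lt_goldenRatio
    rw [abs_lt] at h6
    rw [abs_le] at h0
    have hl : (-7 : ℝ) < s.1 := by exact_mod_cast h6.1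
    have hu : (s.1 : ℝ) < 7 := by exact_mod_cast h6.2
    have h4 : (-20 : ℝ) ≤ s.2.1 := by nlinarith
    have h5 : (s.2.1 : ℝ) ≤ 20 := by nlinarith
    refine ⟨⟨?_, ?_⟩, ⟨?_, ?_⟩, trivial⟩
    · exact Int.add_one_le_of_lt h6.1
    · exact Int.le_of_lt_add_one h6.2
    · exact_mod_cast h4
    · exact_mod_cast h5
  have := hT.to_subtype
  refine Finite.of_injective (fun s : adder.State => (⟨s.1.1, key s⟩ : T)) fun s t h => ?_
  have heq : (s.1.1 : adderDiff.State) = t.1.1 := Subtype.mk.inj h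
  exact Subtype.ext (Subtype.ext heq)

/-! Zeckendorf representations are unique up to leading zeros. Hence a state of the reduced
automaton for `[x] = c` is determined by the value of any word leading to it, and this value is that
of a prefix of one fixed representation of `c`. So the automaton has only `O(log c)` states
(`Represents.card_le`).

The subset construction does not blow up. A reachable set consists of pairs (state of `M'`, state of
the fixed second factor) reached by words with one common track `x`. The addition automaton has
finitely many states, so `[x] + [y] - [z]` is bounded along its runs (`exists_adder_bound`);
therefore all values `[y]` occurring in one reachable set lie in a window of bounded length. As
values determine states of `M'`, such a set is coded by one anchor state and a subset of a bounded
set. With `n` states in `M'` there are `O(n)` reachable sets, each of bounded size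
(`card_le_of_window`, `ncard_le_of_window`).

Everything in a translation except the partition refinement is thus linear in `n`. The refinement
costs `O(n log n)` whatever the order of the splitters, by the smaller-half argument in the form of
a potential (`potential_process`); `translation_bound` collects these costs. There are at most two
translations per binary digit of `c`, each with `n = O(log c)`, and the bound follows. -/

/-! ### Values of Zeckendorf words: existence, uniqueness, growth. -/

theorem validFib_cons_false (w : List Bool) : ValidFib (false :: w) ↔ ValidFib w := by
  cases w <;> simp [ValidFib, List.isChain_cons_cons]

theorem ValidFib.tail {b : Bool} {w : List Bool} (h : ValidFib (b :: w)) : ValidFib w :=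
  List.IsChain.tail h

theorem validFib_true_cons {w : List Bool} (h : ValidFib (true :: w)) :
    w = [] ∨ ∃ v, w = false :: v := by
  rcases w with _ | ⟨b, v⟩
  · exact Or.inl rfl
  · right
    cases b
    · exact ⟨v, rfl⟩
    · simp [ValidFib, List.isChain_cons_cons] at h

theorem fibVal_append (x y : List Bool) :
    fibVal (x ++ y) = fibVal (x ++ List.replicate y.length false) + fibVal y := by
  induction x with
  | nil =>
    have h : ∀ n, fibVal (List.replicate n false) = 0 := fun n => by
      induction n with
      | zero => rfl
      | succ n ih => simp [List.replicate_succ, fibVal, ih]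
    simp [h]
  | cons b x ih => simp [fibVal, ih, add_assoc]

/-- Each weight obeys the Fibonacci recurrence. This is why two consecutive differences suffice as a
state of `adderDiff`; `fibVal_concat` and `fibVal_concat_false` match its two updates. -/
theorem fibVal_append_false_false (w : List Bool) :
    fibVal (w ++ [false, false]) = fibVal (w ++ [false]) + fibVal w := by
  induction w with
  | nil => rfl
  | cons b w ih =>
    have h := Nat.fib_add_two (n := w.length + 2)
    simp only [List.cons_append, fibVal, ih, List.length_append, List.length_cons,
      List.length_nil]
    cases b
    · simp
    · simp only [if_true]
      have e1 : w.length + (0 + 1 + 1) + 2 = w.length + 2 + 2 := by ring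
      have e2 : w.length + (0 + 1) + 2 = w.length + 2 + 1 := by ring
      rw [e1, e2, h]
      ring

theorem fibVal_concat (w : List Bool) (b : Bool) :
    fibVal (w ++ [b]) = fibVal (w ++ [false]) + b.toNat := by
  rw [fibVal_append]
  cases b <;> simp [fibVal]

theorem fibVal_concat_false (w : List Bool) (b : Bool) :
    fibVal (w ++ [b, false]) = fibVal (w ++ [false]) + fibVal w + 2 * b.toNat := by
  rw [fibVal_append, ← fibVal_append_false_false]
  cases b <;> simp [fibVal, Nat.fib_add_two]

theorem fibVal_replicate_append (k : ℕ) (x : List Bool) :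
    fibVal (List.replicate k false ++ x) = fibVal x := by
  induction k with
  | zero => rfl
  | succ k ih => simp [List.replicate_succ, fibVal, ih]

theorem validFib_replicate_append (k : ℕ) (x : List Bool) :
    ValidFib (List.replicate k false ++ x) ↔ ValidFib x := by
  induction k with
  | zero => rfl
  | succ k ih => rw [List.replicate_succ, List.cons_append, validFib_cons_false, ih]

/-- A leading 1 is followed by 0 or by nothing, so the induction drops two letters at once and uses
`F_{n+2} = F_{n+1} + F_n`. -/
theorem fibVal_lt {w : List Bool} (h : ValidFib w) : fibVal w < Nat.fib (w.length + 2) := by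
  suffices H : ∀ n, ∀ w : List Bool, w.length ≤ n → ValidFib w →
      fibVal w < Nat.fib (w.length + 2) from H _ w le_rfl h
  intro n
  induction n with
  | zero =>
    intro w hw _
    rw [List.length_eq_zero_iff.1 (Nat.le_zero.1 hw)]
    decide
  | succ n ih =>
    intro w hw h
    rcases w with _ | ⟨b, w⟩
    · decide
    have hf : Nat.fib (w.length + 2) ≤ Nat.fib (w.length + 1 + 2) := Nat.fib_mono (by omega)
    cases b
    · have := ih w (by simpa using hw) h.tail
      simpa [fibVal] using this.trans_le hf
    · rcases validFib_true_cons h with rfl | ⟨v, rfl⟩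
      · decide
      · have h1 := ih v (by simp at hw; omega) h.tail.tail
        have h2 := Nat.fib_add_two (n := v.length + 2)
        simp only [fibVal, List.length_cons, if_true]
        rw [show v.length + 1 + 1 + 2 = v.length + 2 + 2 by ring, h2,
          show v.length + 1 + 2 = v.length + 2 + 1 by ring]
        simp
        omega

/-- By `fibVal_lt` the tail is worth less than the weight of the leading position, so the value
fixes the leading letter. -/
theorem fibVal_injective {x y : List Bool} (hx : ValidFib x) (hy : ValidFib y)
    (hl : x.length = y.length) (h : fibVal x = fibVal y) : x = y := by
  induction x generalizing y with
  | nil => exact (List.length_eq_zero_iff.1 hl.symm).symm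
  | cons a x ih =>
    rcases y with _ | ⟨b, y⟩
    · simp at hl
    have hl' : x.length = y.length := by simpa using hl
    have h1 := fibVal_lt hx.tail
    have h2 := fibVal_lt hy.tail
    simp only [fibVal, hl'] at h h1
    have hab : a = b := by
      cases a <;> cases b <;> simp at h ⊢ <;> omega
    subst hab
    rw [ih hx.tail hy.tail hl' (by omega)]

theorem eq_replicate_append {x y : List Bool} (hx : ValidFib x) (hy : ValidFib y)
    (hl : x.length ≤ y.length) (h : fibVal x = fibVal y) :
    y = List.replicate (y.length - x.length) false ++ x :=
  fibVal_injective hy ((validFib_replicate_append _ _).2 hx) (by simp; omega)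
    (by rw [fibVal_replicate_append, h])

/-- Greedy choice: if the leading weight fits into `c`, the remainder is so small that the next
letter can be 0. -/
theorem exists_validFib (n c : ℕ) (h : c < Nat.fib (n + 2)) :
    ∃ w, w.length = n ∧ ValidFib w ∧ fibVal w = c := by
  induction n using Nat.strong_induction_on generalizing c with
  | _ n ih =>
    rcases n with _ | _ | n
    · refine ⟨[], rfl, List.isChain_nil, ?_⟩
      simp [Nat.fib_add_two] at h
      simp [fibVal, h]
    · have : c < 2 := h
      interval_cases c
      · exact ⟨[false], rfl, List.isChain_singleton _, rfl⟩
      · exact ⟨[true], rfl, List.isChain_singleton _, rfl⟩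
    · by_cases hc : c < Nat.fib (n + 1 + 2)
      · obtain ⟨w, hw, hv, hf⟩ := ih (n + 1) (by omega) c hc
        exact ⟨false :: w, by simp [hw], (validFib_cons_false _).2 hv, by simp [fibVal, hf]⟩
      · have h2 := Nat.fib_add_two (n := n + 2)
        have h3 : c < Nat.fib (n + 2) + Nat.fib (n + 2 + 1) := h2 ▸ h
        have e : n + 1 + 2 = n + 2 + 1 := by ring
        rw [e] at hc
        obtain ⟨w, hw, hv, hf⟩ := ih n (by omega) (c - Nat.fib (n + 2 + 1)) (by omega)
        refine ⟨true :: false :: w, by simp [hw], ?_, ?_⟩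
        · have := (validFib_cons_false _).2 hv
          simp only [ValidFib, List.isChain_cons_cons] at this ⊢
          exact ⟨by simp, this⟩
        · simp only [fibVal, List.length_cons, hw, hf, if_true, Bool.false_eq_true, if_false, e]
          omega

/-- Valid words of the same value have the same continuations. -/
theorem validFib_append_congr {y y' : List Bool} (hy : ValidFib y) (hy' : ValidFib y')
    (h : fibVal y = fibVal y') (z : List Bool) :
    (ValidFib (y ++ z) ↔ ValidFib (y' ++ z)) ∧ fibVal (y ++ z) = fibVal (y' ++ z) := by
  wlog hl : y.length ≤ y'.length generalizing y y'
  · have := this hy' hy h.symm (by omega)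
    exact ⟨this.1.symm, this.2.symm⟩
  rw [eq_replicate_append hy hy' hl h, List.append_assoc, validFib_replicate_append,
    fibVal_replicate_append]
  exact ⟨Iff.rfl, rfl⟩

/-- Two more letters at least double the range, so every `c < 2 ^ n` has a representation of length
`2 * n`. -/
theorem two_pow_le_fib (n : ℕ) : 2 ^ n ≤ Nat.fib (2 * n + 2) := by
  induction n with
  | zero => decide
  | succ n ih =>
    have h1 := Nat.fib_add_two (n := 2 * n + 2)
    have h2 : Nat.fib (2 * n + 2) ≤ Nat.fib (2 * n + 2 + 1) := Nat.fib_mono (by omega)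
    rw [show 2 * (n + 1) + 2 = 2 * n + 2 + 2 by ring, pow_succ]
    omega

theorem ValidFib.append_left {x y : List Bool} (h : ValidFib (x ++ y)) : ValidFib x :=
  List.IsChain.left_of_append h

/-! ### Runs and languages of the constructed automata. -/

namespace PDFA

variable {α β : Type}

theorem run_append (A : PDFA α) (s : A.State) (v w : List α) :
    A.run s (v ++ w) = (A.run s v).bind fun t => A.run t w := by
  induction v generalizing s with
  | nil => rfl
  | cons a v ih =>
    simp only [List.cons_append, run]
    cases A.step s a with
    | none => rfl
    | some t => simp [ih]

theorem run_cons (A : PDFA α) (s : A.State) (a : α) (w : List α) (t : A.State) :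
    A.run s (a :: w) = some t ↔ ∃ r, A.step s a = some r ∧ A.run r w = some t := by
  simp [run, Option.bind_eq_some_iff]

theorem run_append_eq_some (A : PDFA α) (s : A.State) (v w : List α) (t : A.State) :
    A.run s (v ++ w) = some t ↔ ∃ r, A.run s v = some r ∧ A.run r w = some t := by
  rw [run_append, Option.bind_eq_some_iff]

theorem run_concat (A : PDFA α) (s : A.State) (v : List α) (a : α) (t : A.State) :
    A.run s (v ++ [a]) = some t ↔ ∃ r, A.run s v = some r ∧ A.step r a = some t := by
  rw [run_append_eq_some]
  simp [run]

theorem restrict_step (A : PDFA α) (P : A.State → Prop) (h : P A.start)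
    (s t : (A.restrict P h).State) (a : α) :
    (A.restrict P h).step s a = some t ↔ A.step s.1 a = some t.1 := by
  constructor
  · intro ht
    have := run_restrict A P h [a] s t (by simpa [run] using ht)
    simpa [run] using this
  · intro ht
    change (A.step s.1 a).bind _ = _
    rw [ht, Option.bind_some, dif_pos t.2]
    rfl

theorem restrict_run_of (A : PDFA α) (P : A.State → Prop) (h : P A.start) (w : List α)
    (s t : (A.restrict P h).State) (hr : A.run s.1 w = some t.1)
    (hP : ∀ u v r, w = u ++ v → A.run s.1 u = some r → A.run r v = some t.1 → P r) :
    (A.restrict P h).run s w = some t := by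
  induction w generalizing s with
  | nil =>
    simp only [run, Option.some.injEq] at hr ⊢
    exact Subtype.ext hr
  | cons a w ih =>
    obtain ⟨q, hq, hw⟩ := (A.run_cons _ _ _ _).1 hr
    have hPq : P q := hP [a] w q rfl (by simp [run, hq]) hw
    refine (run_cons _ _ _ _ _).2 ⟨⟨q, hPq⟩, (restrict_step _ _ _ _ _ _).2 hq, ?_⟩
    refine ih ⟨q, hPq⟩ hw fun u v r hu h1 h2 => hP (a :: u) v r (by simp [hu]) ?_ h2
    exact (run_cons _ _ _ _ _).2 ⟨q, hq, h1⟩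

theorem accessible_run (A : PDFA α) (w : List α) (t : A.accessible.State) :
    A.accessible.run A.accessible.start w = some t ↔ A.run A.start w = some t.1 := by
  refine ⟨fun h => run_restrict _ _ _ _ _ _ h, fun h => restrict_run_of _ _ _ _ _ _ h ?_⟩
  exact fun u v r _ hu _ => ⟨u, hu⟩

theorem accessible_isAccessible (A : PDFA α) (t : A.accessible.State) :
    A.accessible.IsAccessible t := by
  obtain ⟨w, hw⟩ := t.2
  exact ⟨w, (A.accessible_run w t).2 hw⟩

theorem accessible_language (A : PDFA α) : A.accessible.language = A.language := by
  ext w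
  constructor
  · rintro ⟨q, hq, hw⟩
    exact ⟨q.1, hq, (A.accessible_run w q).1 hw⟩
  · rintro ⟨q, hq, hw⟩
    exact ⟨⟨q, w, hw⟩, hq, (A.accessible_run w ⟨q, w, hw⟩).2 hw⟩

theorem trim_run_of_coaccessible (A : PDFA α) (w : List α) (s t : A.trim.State)
    (h : A.run s.1 w = some t.1) (ht : A.IsCoaccessible t.1) : A.trim.run s w = some t := by
  refine restrict_run_of _ _ _ _ _ _ h fun u v r _ _ hv => Or.inl ?_
  obtain ⟨z, q, hq, hz⟩ := ht
  exact ⟨v ++ z, q, hq, (run_append_eq_some _ _ _ _ _).2 ⟨_, hv, hz⟩⟩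

theorem isCoaccessible_of_accept (A : PDFA α) {q : A.State} (h : q ∈ A.accept) :
    A.IsCoaccessible q := ⟨[], q, h, rfl⟩

theorem trim_language (A : PDFA α) : A.trim.language = A.language := by
  ext w
  constructor
  · rintro ⟨q, hq, hw⟩
    exact ⟨q.1, hq, run_restrict _ _ _ _ _ _ hw⟩
  · rintro ⟨q, hq, hw⟩
    have hc := A.isCoaccessible_of_accept hq
    exact ⟨⟨q, Or.inl hc⟩, hq, trim_run_of_coaccessible A w _ ⟨q, Or.inl hc⟩ hw hc⟩

theorem trim_isAccessible (A : PDFA α) (hA : ∀ s, A.IsAccessible s) (s : A.trim.State) :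
    A.trim.IsAccessible s := by
  rcases s with ⟨s, hs | rfl⟩
  · obtain ⟨w, hw⟩ := hA s
    exact ⟨w, trim_run_of_coaccessible A w _ ⟨s, _⟩ hw hs⟩
  · exact ⟨[], rfl⟩

/-- `trim` keeps the start state even if it is dead; a nonempty language rules this out. -/
theorem trim_isCoaccessible (A : PDFA α) (hA : A.language.Nonempty) (s : A.trim.State) :
    A.trim.IsCoaccessible s := by
  have hs : A.IsCoaccessible s.1 := by
    rcases s.2 with h | h
    · exact h
    · rw [h]
      obtain ⟨w, q, hq, hw⟩ := hA
      exact ⟨w, q, hq, hw⟩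
  obtain ⟨w, q, hq, hw⟩ := hs
  have hc := A.isCoaccessible_of_accept hq
  exact ⟨w, ⟨q, Or.inl hc⟩, hq, trim_run_of_coaccessible A w s ⟨q, Or.inl hc⟩ hw hc⟩

theorem comap_run (f : β → α) (A : PDFA α) (s : A.State) (w : List β) :
    (A.comap f).run s w = A.run s (w.map f) := by
  induction w generalizing s with
  | nil => rfl
  | cons b w ih =>
    simp only [run, List.map_cons]
    exact congrArg _ (funext fun t => ih t)

theorem prod_step (A B : PDFA α) (s t : (A.prod B).State) (a : α) :
    (A.prod B).step s a = some t ↔ A.step s.1 a = some t.1 ∧ B.step s.2 a = some t.2 := by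
  change (A.step s.1 a).bind _ = _ ↔ _
  rcases t with ⟨t₁, t₂⟩
  cases A.step s.1 a <;> cases B.step s.2 a <;> simp
  exact Option.some_inj.trans Prod.mk_inj

theorem prod_run (A B : PDFA α) (s t : (A.prod B).State) (w : List α) :
    (A.prod B).run s w = some t ↔ A.run s.1 w = some t.1 ∧ B.run s.2 w = some t.2 := by
  induction w generalizing s with
  | nil =>
    rcases s with ⟨s₁, s₂⟩
    rcases t with ⟨t₁, t₂⟩
    simp only [run, Option.some.injEq]
    exact Option.some_inj.trans Prod.mk_inj
  | cons a w ih =>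
    simp only [run_cons, prod_step, ih]
    constructor
    · rintro ⟨r, ⟨h1, h2⟩, h3, h4⟩
      exact ⟨⟨_, h1, h3⟩, ⟨_, h2, h4⟩⟩
    · rintro ⟨⟨r₁, h1, h3⟩, ⟨r₂, h2, h4⟩⟩
      exact ⟨(r₁, r₂), ⟨h1, h2⟩, h3, h4⟩

theorem inter_run (A B : PDFA α) (t : (A.inter B).State) (w : List α) :
    (A.inter B).run (A.inter B).start w = some t ↔
      A.run A.start w = some t.1.1 ∧ B.run B.start w = some t.1.2 := by
  exact (accessible_run _ _ _).trans (prod_run _ _ _ _ _)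

theorem mem_inter_language (A B : PDFA α) (w : List α) :
    w ∈ (A.inter B).language ↔ w ∈ A.language ∧ w ∈ B.language := by
  rw [inter, accessible_language]
  constructor
  · rintro ⟨q, hq, hw⟩
    obtain ⟨h1, h2⟩ := (prod_run _ _ _ _ _).1 hw
    exact ⟨⟨_, hq.1, h1⟩, ⟨_, hq.2, h2⟩⟩
  · rintro ⟨⟨p, hp, h1⟩, ⟨q, hq, h2⟩⟩
    exact ⟨(p, q), ⟨hp, hq⟩, (prod_run _ _ _ (p, q) _).2 ⟨h1, h2⟩⟩

theorem mem_comap_language (f : β → α) (A : PDFA α) (w : List β) :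
    w ∈ (A.comap f).language ↔ w.map f ∈ A.language := by
  constructor
  · rintro ⟨q, hq, hw⟩
    exact ⟨q, hq, by rw [← comap_run]; exact hw⟩
  · rintro ⟨q, hq, hw⟩
    exact ⟨q, hq, (comap_run f A _ w).trans hw⟩

theorem powerset_step {σ : Type} (N : NFA α σ) (S T : Set σ) (a : α) :
    N.powerset.step S a = some T ↔ T.Nonempty ∧ T = N.stepSet S a := by
  classical
  have : N.powerset.step S a
      = if (N.stepSet S a).Nonempty then some (N.stepSet S a) else none := by
    simp only [NFA.powerset]
  rw [this]
  split_ifs with h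
  · constructor
    · intro e
      rw [← Option.some.inj e]
      exact ⟨h, rfl⟩
    · rintro ⟨-, rfl⟩
      rfl
  · constructor
    · exact fun e => nomatch e
    · rintro ⟨h', e⟩
      exact absurd (e ▸ h') h

theorem mem_project_stepSet (A : PDFA α) (f : α → β) (S : Set A.State) (b : β) (t : A.State) :
    t ∈ (A.project f).stepSet S b ↔ ∃ s ∈ S, ∃ a, f a = b ∧ A.step s a = some t := by
  simp only [NFA.stepSet, Set.mem_iUnion, exists_prop]
  rfl

/-- The sets met are the sets of ends of lifts of `w`. Nonemptiness appears because the empty set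
counts as undefined. -/
theorem powerset_run (A : PDFA α) (f : α → β) (w : List β) (S : Set A.State)
    (hS : S.Nonempty) (T : Set A.State) :
    (A.project f).powerset.run S w = some T ↔
      T.Nonempty ∧ T = {t | ∃ s ∈ S, ∃ v : List α, v.map f = w ∧ A.run s v = some t} := by
  induction w generalizing S with
  | nil =>
    have : {t | ∃ s ∈ S, ∃ v : List α, v.map f = [] ∧ A.run s v = some t} = S := by
      ext t
      simp [run]
    rw [this]
    constructor
    · intro h
      obtain rfl : S = T := Option.some.inj h
      exact ⟨hS, rfl⟩
    · exact fun h => congrArg some h.2.symm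
  | cons b w ih =>
    refine (run_cons _ _ _ _ _).trans ?_
    have key : {t | ∃ s ∈ S, ∃ v : List α, v.map f = b :: w ∧ A.run s v = some t}
        = {t | ∃ s ∈ (A.project f).stepSet S b, ∃ v : List α,
            v.map f = w ∧ A.run s v = some t} := by
      ext t
      simp only [Set.mem_ofPred_eq, mem_project_stepSet]
      constructor
      · rintro ⟨s, hs, v, hv, hr⟩
        rcases v with _ | ⟨a, v⟩
        · simp at hv
        · rw [List.map_cons, List.cons.injEq] at hv
          obtain ⟨r, h1, h2⟩ := (run_cons _ _ _ _ _).1 hr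
          exact ⟨r, ⟨s, hs, a, hv.1, h1⟩, v, hv.2, h2⟩
      · rintro ⟨r, ⟨s, hs, a, ha, h1⟩, v, hv, h2⟩
        exact ⟨s, hs, a :: v, by simp [ha, hv], (run_cons _ _ _ _ _).2 ⟨r, h1, h2⟩⟩
    rw [key]
    constructor
    · rintro ⟨U, hU, hT⟩
      obtain ⟨hne, rfl⟩ := (powerset_step _ _ _ _).1 hU
      exact (ih _ hne).1 hT
    · rintro ⟨hne, rfl⟩
      have hne' : ((A.project f).stepSet S b).Nonempty := by
        obtain ⟨t, s, hs, _⟩ := hne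
        exact ⟨s, hs⟩
      exact ⟨_, (powerset_step _ _ _ _).2 ⟨hne', rfl⟩, (ih _ hne').2 ⟨hne, rfl⟩⟩

theorem determinize_run (A : PDFA α) (f : α → β) (w : List β)
    (T : (A.project f).determinize.State) :
    (A.project f).determinize.run (A.project f).determinize.start w = some T ↔
      (show Set A.State from T.1).Nonempty ∧ (show Set A.State from T.1)
        = {t | ∃ v : List α, v.map f = w ∧ A.run A.start v = some t} := by
  refine (accessible_run _ _ _).trans ?_
  refine (powerset_run A f w {A.start} ⟨_, rfl⟩ T.1).trans ?_
  simp

theorem determinize_state (A : PDFA α) (f : α → β) (T : (A.project f).determinize.State) :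
    (show Set A.State from T.1).Nonempty ∧ ∃ w : List β, (show Set A.State from T.1)
        = {t | ∃ v : List α, v.map f = w ∧ A.run A.start v = some t} := by
  obtain ⟨w, hw⟩ := accessible_isAccessible _ T
  have := (determinize_run A f w T).1 hw
  exact ⟨this.1, w, this.2⟩

theorem mem_determinize_language (A : PDFA α) (f : α → β) (w : List β) :
    w ∈ (A.project f).determinize.language ↔ ∃ v ∈ A.language, v.map f = w := by
  rw [NFA.determinize, accessible_language]
  constructor
  · rintro ⟨T, ⟨t, ht, hta⟩, hT⟩
    obtain ⟨-, rfl⟩ := (powerset_run A f w {A.start} ⟨_, rfl⟩ T).1 hT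
    obtain ⟨s, rfl, v, hv, hr⟩ := ht
    exact ⟨v, ⟨t, hta, hr⟩, hv⟩
  · rintro ⟨v, ⟨t, hta, hr⟩, hv⟩
    have ht : t ∈ {t | ∃ s ∈ ({A.start} : Set A.State), ∃ v : List α,
        v.map f = w ∧ A.run s v = some t} := ⟨A.start, rfl, v, hv, hr⟩
    exact ⟨_, ⟨t, ht, hta⟩, (powerset_run A f w {A.start} ⟨_, rfl⟩ _).2 ⟨⟨t, ht⟩, rfl⟩⟩

end PDFA

/-! ### Partition refinement: correctness and cost. -/

namespace PDFA

variable {α : Type}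

/-- The words that lead from the state `s` to an accepting state. -/
def residual (A : PDFA α) (s : A.State) : Set (List α) :=
  {w | ∃ q ∈ A.accept, A.run s w = some q}

theorem cons_mem_residual (A : PDFA α) (s : A.State) (a : α) (w : List α) :
    a :: w ∈ A.residual s ↔ ∃ t, A.step s a = some t ∧ w ∈ A.residual t := by
  constructor
  · rintro ⟨q, hq, hw⟩
    obtain ⟨t, h1, h2⟩ := (run_cons _ _ _ _ _).1 hw
    exact ⟨t, h1, q, hq, h2⟩
  · rintro ⟨t, h1, q, hq, h2⟩
    exact ⟨q, hq, (run_cons _ _ _ _ _).2 ⟨t, h1, h2⟩⟩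

theorem nil_mem_residual (A : PDFA α) (s : A.State) : [] ∈ A.residual s ↔ s ∈ A.accept := by
  constructor
  · rintro ⟨q, hq, hw⟩
    rwa [Option.some.inj hw]
  · exact fun h => ⟨s, h, rfl⟩

theorem residual_step_congr (A : PDFA α) {s t s' t' : A.State} {a : α}
    (h : A.residual s = A.residual t) (hs : A.step s a = some s') (ht : A.step t a = some t') :
    A.residual s' = A.residual t' := by
  ext w
  have h1 := A.cons_mem_residual s a w
  have h2 := A.cons_mem_residual t a w
  rw [h] at h1
  constructor
  · intro hw
    obtain ⟨r, hr, hrw⟩ := h2.1 (h1.2 ⟨s', hs, hw⟩)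
    rw [ht] at hr
    rwa [Option.some.inj hr]
  · intro hw
    obtain ⟨r, hr, hrw⟩ := h1.1 (h2.2 ⟨t', ht, hw⟩)
    rw [hs] at hr
    rwa [Option.some.inj hr]

/-- Without dead states, even the domain of the partial transition function is visible in the
residual. -/
theorem exists_step_of_residual_eq (A : PDFA α) (hA : ∀ s, A.IsCoaccessible s)
    {s t s' : A.State} {a : α} (h : A.residual s = A.residual t) (hs : A.step s a = some s') :
    ∃ t', A.step t a = some t' := by
  obtain ⟨w, hw⟩ := hA s'
  have := (A.cons_mem_residual s a w).2 ⟨s', hs, hw⟩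
  rw [h] at this
  obtain ⟨t', h1, _⟩ := (A.cons_mem_residual t a w).1 this
  exact ⟨t', h1⟩

/-! ### The parts of a block -/

/-- The part of `B`, with respect to `X`, in which `s` lies. -/
def cell {σ : Type} (B X : Set σ) (s : σ) : Set σ := {t | t ∈ B ∧ (t ∈ X ↔ s ∈ X)}

section cell

variable {σ : Type} {B X D : Set σ} {s t : σ}

theorem mem_cell_self (hs : s ∈ B) : s ∈ cell B X s := ⟨hs, Iff.rfl⟩

theorem cell_subset : cell B X s ⊆ B := fun _ h => h.1

theorem cell_eq (h : t ∈ cell B X s) : cell B X t = cell B X s := by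
  ext u
  have := h.2
  simp only [cell, Set.mem_ofPred_eq]
  tauto

theorem cell_of_mem (h : s ∈ X) : cell B X s = B ∩ X := by
  ext u
  simp [cell, h]

theorem cell_of_notMem (h : s ∉ X) : cell B X s = B \ X := by
  ext u
  simp [cell, h]

theorem cell_of_not_splits (h : ¬ Splits X B) (hs : s ∈ B) : cell B X s = B := by
  ext u
  refine ⟨fun h => h.1, fun hu => ⟨hu, ?_⟩⟩
  by_contra hc
  apply h
  by_cases hX : s ∈ X
  · exact ⟨⟨s, hs, hX⟩, ⟨u, hu, fun hu' => hc ⟨fun _ => hX, fun _ => hu'⟩⟩⟩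
  · refine ⟨⟨u, hu, ?_⟩, ⟨s, hs, hX⟩⟩
    by_contra hu'
    exact hc ⟨fun h => absurd h hu', fun h => absurd h hX⟩

theorem smallerPart_eq : smallerPart X B = B ∩ X ∨ smallerPart X B = B \ X := by
  classical
  unfold smallerPart
  split_ifs
  · exact Or.inl rfl
  · exact Or.inr rfl

theorem two_mul_ncard_smallerPart_le [Finite σ] : 2 * (smallerPart X B).ncard ≤ B.ncard := by
  have h := Set.ncard_inter_add_ncard_sdiff_eq_ncard B X (Set.toFinite _)
  classical
  unfold smallerPart
  split_ifs with hc <;> omega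

end cell

namespace Refinement

variable {A : PDFA α} {R : A.Refinement}

/-- The invariants of the partition refinement. -/
structure Valid (R : A.Refinement) : Prop where
  nonempty : ∀ B ∈ R.blocks, B.Nonempty
  cover : ∀ s, ∃ B ∈ R.blocks, s ∈ B
  eq_of_mem : ∀ B ∈ R.blocks, ∀ B' ∈ R.blocks, ∀ s ∈ B, s ∈ B' → B = B'
  work_subset : ∀ p ∈ R.work, p.1 ∈ R.blocks
  accept : ∀ B ∈ R.blocks, ∀ s ∈ B, ∀ t ∈ B, s ∈ A.accept → t ∈ A.accept
  nerode : ∀ s t, A.residual s = A.residual t → ∀ B ∈ R.blocks, s ∈ B → t ∈ B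
  -- Two states of a block that disagree on `a` will still be separated: the block of one of the two
  -- successors is pending. If `t` has no transition on `a`, it must be the block of the successor
  -- of `s`.
  pending : ∀ B ∈ R.blocks, ∀ s ∈ B, ∀ t ∈ B, ∀ a, ∀ C ∈ R.blocks,
    s ∈ A.preimage C a → t ∉ A.preimage C a →
      (C, a) ∈ R.work ∨ ∃ C' ∈ R.blocks, t ∈ A.preimage C' a ∧ (C', a) ∈ R.work

theorem mem_process_blocks (hR : R.Valid) (C : Set A.State) (a : α) (D : Set A.State) :
    D ∈ (R.process C a).blocks ↔
      ∃ B ∈ R.blocks, ∃ s ∈ B, D = cell B (A.preimage C a) s := by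
  constructor
  · rintro ⟨B, hB, ⟨h, rfl⟩ | ⟨⟨⟨s, hs, hs'⟩, t, ht, ht'⟩, rfl | rfl⟩⟩
    · obtain ⟨s, hs⟩ := hR.nonempty _ hB
      exact ⟨_, hB, s, hs, (cell_of_not_splits h hs).symm⟩
    · exact ⟨B, hB, s, hs, (cell_of_mem hs').symm⟩
    · exact ⟨B, hB, t, ht, (cell_of_notMem ht').symm⟩
  · rintro ⟨B, hB, s, hs, rfl⟩
    refine ⟨B, hB, ?_⟩
    by_cases h : Splits (A.preimage C a) B
    · refine Or.inr ⟨h, ?_⟩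
      by_cases hX : s ∈ A.preimage C a
      · exact Or.inl (cell_of_mem hX)
      · exact Or.inr (cell_of_notMem hX)
    · exact Or.inl ⟨h, cell_of_not_splits h hs⟩

/-- A cell is nonempty and the blocks are disjoint, so only one old block can have produced it. -/
theorem process_work_iff (hR : R.Valid) (C : Set A.State) (a : α) {B : Set A.State}
    (hB : B ∈ R.blocks) {s : A.State} (hs : s ∈ B) (b : α) :
    (cell B (A.preimage C a) s, b) ∈ (R.process C a).work ↔
      ((B, b) ∈ R.work ∧ (B, b) ≠ (C, a)) ∨
        (Splits (A.preimage C a) B ∧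
          cell B (A.preimage C a) s = smallerPart (A.preimage C a) B) := by
  set X := A.preimage C a with hX
  have hsub : ∀ B' ∈ R.blocks, cell B X s ⊆ B' → B' = B := fun B' hB' h =>
    hR.eq_of_mem _ hB' _ hB s (h (mem_cell_self hs)) hs
  constructor
  · rintro ⟨B', hB', ⟨h, h1, h2⟩ | ⟨h, h1, h2⟩⟩
    · obtain rfl := hsub B' hB' h1.le
      exact Or.inl h2
    · have : B' = B := by
        apply hsub B' hB'
        rcases h1 with h1 | h1
        · exact h1.le.trans Set.inter_subset_left
        · exact h1.le.trans Set.sdiff_subset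
      subst this
      rcases h2 with h2 | h2
      · exact Or.inl h2
      · exact Or.inr ⟨h, h2⟩
  · intro h
    refine ⟨B, hB, ?_⟩
    by_cases hsp : Splits X B
    · refine Or.inr ⟨hsp, ?_, ?_⟩
      · by_cases hsX : s ∈ X
        · exact Or.inl (cell_of_mem hsX)
        · exact Or.inr (cell_of_notMem hsX)
      · rcases h with h | h
        · exact Or.inl h
        · exact Or.inr h.2
    · refine Or.inl ⟨hsp, cell_of_not_splits hsp hs, ?_⟩
      rcases h with h | h
      · exact h
      · exact absurd h.1 hsp

theorem mem_preimage_congr (hA : ∀ s, A.IsCoaccessible s) {s t : A.State} {a : α}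
    {C : Set A.State} (hC : ∀ s t, A.residual s = A.residual t → s ∈ C → t ∈ C)
    (h : A.residual s = A.residual t) (hs : s ∈ A.preimage C a) : t ∈ A.preimage C a := by
  obtain ⟨s', hs', h1⟩ := hs
  obtain ⟨t', h2⟩ := exists_step_of_residual_eq A hA h h1
  exact ⟨t', hC _ _ (residual_step_congr A h h1 h2) hs', h2⟩

theorem Valid.process (hA : ∀ s, A.IsCoaccessible s) (hR : R.Valid) {C : Set A.State} {a : α}
    (hC : (C, a) ∈ R.work) : (R.process C a).Valid := by
  set X := A.preimage C a with hX
  have hCb := hR.work_subset _ hC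
  refine ⟨?_, ?_, ?_, ?_, ?_, ?_, ?_⟩
  · intro D hD
    obtain ⟨B, hB, s, hs, rfl⟩ := (mem_process_blocks hR C a D).1 hD
    exact ⟨s, mem_cell_self hs⟩
  · intro s
    obtain ⟨B, hB, hs⟩ := hR.cover s
    exact ⟨_, (mem_process_blocks hR C a _).2 ⟨B, hB, s, hs, rfl⟩, mem_cell_self hs⟩
  · intro D hD D' hD' u hu hu'
    obtain ⟨B, hB, s, hs, rfl⟩ := (mem_process_blocks hR C a D).1 hD
    obtain ⟨B', hB', s', hs', rfl⟩ := (mem_process_blocks hR C a D').1 hD'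
    obtain rfl := hR.eq_of_mem _ hB _ hB' u hu.1 hu'.1
    rw [← cell_eq hu, ← cell_eq hu']
  · rintro ⟨D, b⟩ ⟨B, hB, h⟩
    refine ⟨B, hB, ?_⟩
    rcases h with ⟨h1, h2, -⟩ | ⟨h1, h2, -⟩
    · exact Or.inl ⟨h1, h2⟩
    · exact Or.inr ⟨h1, h2⟩
  · intro D hD s hs t ht
    obtain ⟨B, hB, u, hu, rfl⟩ := (mem_process_blocks hR C a D).1 hD
    exact hR.accept B hB s hs.1 t ht.1
  · intro s t h D hD hs
    obtain ⟨B, hB, u, hu, rfl⟩ := (mem_process_blocks hR C a D).1 hD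
    refine ⟨hR.nerode s t h B hB hs.1, Iff.trans ?_ hs.2⟩
    have hn := fun s t h => hR.nerode s t h C hCb
    exact ⟨mem_preimage_congr hA hn h.symm, mem_preimage_congr hA hn h⟩
  · intro D hD s hs t ht b E hE hsE htE
    obtain ⟨B, hB, u, hu, rfl⟩ := (mem_process_blocks hR C a D).1 hD
    obtain ⟨B', hB', v, hv, rfl⟩ := (mem_process_blocks hR C a E).1 hE
    have hst : s ∈ X ↔ t ∈ X := hs.2.trans ht.2.symm
    obtain ⟨s', hs', h1⟩ := hsE
    rw [← cell_eq hs'] at htE hE ⊢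
    have hs'B := hs'.1
    -- If both successors lay in the same old block, it is this step that separates them; one of
    -- their two cells is the smaller part, which becomes pending.
    by_cases hB't : t ∈ A.preimage B' b
    · obtain ⟨t', ht', h2⟩ := hB't
      have hX' : ¬ (t' ∈ X ↔ s' ∈ X) := fun h => htE ⟨t', ⟨ht', h⟩, h2⟩
      have hsp : Splits X B' := by
        by_contra hn
        refine htE ⟨t', ?_, h2⟩
        rwa [cell_of_not_splits hn hs'B]
      have hor : cell B' X s' = smallerPart X B' ∨ cell B' X t' = smallerPart X B' := by
        by_cases hs'X : s' ∈ X
        · have ht'X : t' ∉ X := fun h => hX' ⟨fun _ => hs'X, fun _ => h⟩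
          rw [cell_of_mem hs'X, cell_of_notMem ht'X]
          rcases smallerPart_eq (X := X) (B := B') with h | h <;> simp [h]
        · have ht'X : t' ∈ X := by
            by_contra h
            exact hX' ⟨fun h' => absurd h' h, fun h' => absurd h' hs'X⟩
          rw [cell_of_notMem hs'X, cell_of_mem ht'X]
          rcases smallerPart_eq (X := X) (B := B') with h | h <;> simp [h]
      rcases hor with h | h
      · exact Or.inl ((process_work_iff hR C a hB' hs'B b).2 (Or.inr ⟨hsp, h⟩))
      · exact Or.inr ⟨_, (mem_process_blocks hR C a _).2 ⟨B', hB', t', ht', rfl⟩,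
          ⟨t', mem_cell_self ht', h2⟩,
          (process_work_iff hR C a hB' ht' b).2 (Or.inr ⟨hsp, h⟩)⟩
    -- Otherwise a splitter was pending before, and the relevant part of it still is, unless it is
    -- the processed `(C, a)`. But then `X` would separate `s` from `t`, although they share a cell.
    · rcases hR.pending B hB s hs.1 t ht.1 b B' hB' ⟨s', hs'B, h1⟩ hB't with h | ⟨C', hC', h, h'⟩
      · left
        refine (process_work_iff hR C a hB' hs'B b).2 (Or.inl ⟨h, fun heq => ?_⟩)
        obtain ⟨rfl, rfl⟩ := Prod.mk_inj.1 heq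
        exact hB't (hst.1 ⟨s', hs'B, h1⟩)
      · right
        obtain ⟨t', ht', h2⟩ := h
        refine ⟨_, (mem_process_blocks hR C a _).2 ⟨C', hC', t', ht', rfl⟩,
          ⟨t', mem_cell_self ht', h2⟩,
          (process_work_iff hR C a hC' ht' b).2 (Or.inl ⟨h', fun heq => ?_⟩)⟩
        obtain ⟨rfl, rfl⟩ := Prod.mk_inj.1 heq
        obtain ⟨s'', hs'', h3⟩ := hst.2 ⟨t', ht', h2⟩
        rw [h1] at h3
        obtain rfl := Option.some.inj h3
        obtain rfl := hR.eq_of_mem _ hB' _ hC' _ hs'B hs''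
        exact hB't ⟨t', ht', h2⟩

theorem initialRefinement_valid (A : PDFA α) : A.initialRefinement.Valid where
  nonempty := fun _ h => h.1
  cover := fun s => by
    by_cases h : s ∈ A.accept
    · exact ⟨_, ⟨⟨s, h⟩, Or.inl rfl⟩, h⟩
    · exact ⟨_, ⟨⟨s, h⟩, Or.inr rfl⟩, h⟩
  eq_of_mem := by
    rintro B ⟨-, rfl | rfl⟩ B' ⟨-, rfl | rfl⟩ s hs hs'
    · rfl
    · exact absurd hs hs'
    · exact absurd hs' hs
    · rfl
  work_subset := fun _ h => h
  accept := by
    rintro B ⟨-, rfl | rfl⟩ s hs t ht h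
    · exact ht
    · exact absurd h hs
  nerode := by
    intro s t h B hB hs
    have h' : s ∈ A.accept ↔ t ∈ A.accept := by
      rw [← nil_mem_residual, ← nil_mem_residual, h]
    rcases hB with ⟨-, rfl | rfl⟩
    · exact h'.1 hs
    · exact fun ht => hs (h'.2 ht)
  pending := fun _ _ _ _ _ _ _ _ hC _ _ => Or.inl hC

/-! ### The potential -/

/-- The block of `s`. -/
def block (R : A.Refinement) (s : A.State) : Set A.State :=
  {t | ∀ B ∈ R.blocks, s ∈ B → t ∈ B}

theorem Valid.block_eq (hR : R.Valid) {B : Set A.State} (hB : B ∈ R.blocks) {s : A.State}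
    (hs : s ∈ B) : R.block s = B := by
  ext t
  refine ⟨fun h => h B hB hs, fun ht B' hB' hs' => ?_⟩
  rwa [← hR.eq_of_mem _ hB _ hB' s hs hs']

open Classical in
/-- A bound for the number of times that `s` still lies in a splitter processed with the
letter `b`. -/
noncomputable def statePotential (R : A.Refinement) (s : A.State) (b : α) : ℕ :=
  Nat.log 2 (R.block s).ncard + if (R.block s, b) ∈ R.work then 1 else 0

open Classical in
-- Processing the block of `s` uses up its pending mark. A mark not inherited from a splitter that
-- stays pending goes only to a smaller part, at most half of the block, so the logarithm drops by
-- one and pays for it.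
theorem statePotential_process [Finite A.State] (hA : ∀ s, A.IsCoaccessible s) (hR : R.Valid)
    {C : Set A.State} {a : α} (hC : (C, a) ∈ R.work) (s : A.State) (b : α) :
    (R.process C a).statePotential s b + (if s ∈ C ∧ b = a then 1 else 0) ≤
      R.statePotential s b := by
  obtain ⟨B, hB, hs⟩ := hR.cover s
  have hR' := hR.process hA hC
  have hD : cell B (A.preimage C a) s ∈ (R.process C a).blocks :=
    (mem_process_blocks hR C a _).2 ⟨B, hB, s, hs, rfl⟩
  have hiff := process_work_iff hR C a hB hs b
  have hCB : s ∈ C ∧ b = a ↔ (B, b) = (C, a) := by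
    rw [Prod.mk_inj]
    refine and_congr_left fun _ => ⟨fun h => ?_, fun h => h ▸ hs⟩
    exact hR.eq_of_mem _ hB _ (hR.work_subset _ hC) s hs h
  simp only [statePotential, hR.block_eq hB hs, hR'.block_eq hD (mem_cell_self hs), hCB]
  have hlog : Nat.log 2 (cell B (A.preimage C a) s).ncard ≤ Nat.log 2 B.ncard :=
    Nat.log_mono_right (Set.ncard_le_ncard cell_subset (Set.toFinite _))
  by_cases h1 : (B, b) = (C, a)
  · have h2 : (B, b) ∈ R.work := h1 ▸ hC
    rw [if_pos h1, if_pos h2]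
    split_ifs with h3
    · rcases hiff.1 h3 with h | h
      · exact absurd h1 h.2
      have h4 := two_mul_ncard_smallerPart_le (X := A.preimage C a) (B := B)
      rw [← h.2] at h4
      have h5 : (cell B (A.preimage C a) s).ncard ≠ 0 :=
        Set.ncard_ne_zero_of_mem (mem_cell_self hs)
      have h6 := Nat.log_mono_right (b := 2) h4
      rw [mul_comm, Nat.log_mul_base one_lt_two h5] at h6
      omega
    · omega
  · rw [if_neg h1]
    by_cases h2 : (B, b) ∈ R.work
    · rw [if_pos h2]
      split_ifs <;> omega
    · rw [if_neg h2]
      split_ifs with h3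
      · rcases hiff.1 h3 with h | h
        · exact absurd h.1 h2
        have h4 := two_mul_ncard_smallerPart_le (X := A.preimage C a) (B := B)
        rw [← h.2] at h4
        have h5 : (cell B (A.preimage C a) s).ncard ≠ 0 :=
          Set.ncard_ne_zero_of_mem (mem_cell_self hs)
        have h6 := Nat.log_mono_right (b := 2) h4
        rw [mul_comm, Nat.log_mul_base one_lt_two h5] at h6
        omega
      · omega

/-- A bound for the cost of the rest of the refinement. -/
noncomputable def potential [Fintype α] [Fintype A.State] (R : A.Refinement) : ℕ :=
  ∑ b, (∑ s, R.statePotential s b +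
    ∑ s, (A.step s b).elim 0 fun t => R.statePotential t b)

open Classical in
theorem ncard_eq_sum {σ : Type} [Fintype σ] (S : Set σ) :
    S.ncard = ∑ s, if s ∈ S then 1 else 0 := by
  rw [Set.ncard_eq_toFinset_card', ← Finset.card_filter]
  congr 1
  ext
  rw [Set.mem_toFinset, Finset.mem_filter]
  exact (and_iff_right (Finset.mem_univ _)).symm

/-- The states of `C` are charged to themselves, and the transitions traversed backwards to their
targets; only the letter `a` pays. -/
theorem potential_process [Fintype α] [Fintype A.State] (hA : ∀ s, A.IsCoaccessible s)
    (hR : R.Valid) {C : Set A.State} {a : α} (hC : (C, a) ∈ R.work) :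
    C.ncard + (A.preimage C a).ncard + (R.process C a).potential ≤ R.potential := by
  classical
  have h := statePotential_process hA hR hC
  have key : ∀ b, (if b = a then C.ncard + (A.preimage C a).ncard else 0) +
      (∑ s, (R.process C a).statePotential s b +
        ∑ s, (A.step s b).elim 0 fun t => (R.process C a).statePotential t b) ≤
      ∑ s, R.statePotential s b + ∑ s, (A.step s b).elim 0 fun t => R.statePotential t b := by
    intro b
    have h1 : ∑ s, (R.process C a).statePotential s b + (if b = a then C.ncard else 0) ≤
        ∑ s, R.statePotential s b := by
      rw [ncard_eq_sum]
      have : (if b = a then ∑ s, (if s ∈ C then 1 else 0) else 0)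
          = ∑ s, if s ∈ C ∧ b = a then 1 else 0 := by
        split_ifs with hb <;> simp [hb]
      rw [this, ← Finset.sum_add_distrib]
      exact Finset.sum_le_sum fun s _ => h s b
    have h2 : ∑ s, ((A.step s b).elim 0 fun t => (R.process C a).statePotential t b) +
          (if b = a then (A.preimage C a).ncard else 0) ≤
        ∑ s, (A.step s b).elim 0 fun t => R.statePotential t b := by
      rw [ncard_eq_sum]
      have : (if b = a then ∑ s, (if s ∈ A.preimage C a then 1 else 0) else 0)
          = ∑ s, if s ∈ A.preimage C a ∧ b = a then 1 else 0 := by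
        split_ifs with hb <;> simp [hb]
      rw [this, ← Finset.sum_add_distrib]
      refine Finset.sum_le_sum fun s _ => ?_
      cases hs : A.step s b with
      | none =>
        have : ¬ (s ∈ A.preimage C a ∧ b = a) := by
          rintro ⟨⟨t, -, ht⟩, rfl⟩
          rw [hs] at ht
          cases ht
        simp [this]
      | some t =>
        have : s ∈ A.preimage C a ∧ b = a ↔ t ∈ C ∧ b = a := by
          refine and_congr_left ?_
          rintro rfl
          constructor
          · rintro ⟨t', ht', h'⟩
            rw [hs] at h'
            rwa [Option.some.inj h']
          · exact fun ht => ⟨t, ht, hs⟩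
        simpa only [this, Option.elim] using h t b
    split_ifs at h1 h2 ⊢ <;> omega
  have := Finset.sum_le_sum fun b (_ : b ∈ Finset.univ) => key b
  rw [Finset.sum_add_distrib, Finset.sum_ite_eq' Finset.univ a] at this
  simpa [potential] using this

theorem RefinesTo.valid_and_le [Fintype α] [Fintype A.State] (hA : ∀ s, A.IsCoaccessible s)
    {P : Set (Set A.State)} {t : ℕ} (h : R.RefinesTo P t) (hR : R.Valid) :
    (Refinement.mk P ∅ : A.Refinement).Valid ∧ t ≤ R.potential := by
  induction h with
  | done P => exact ⟨hR, Nat.zero_le _⟩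
  | process R C a P t hC _ ih =>
    obtain ⟨h1, h2⟩ := ih (hR.process hA hC)
    have h3 := potential_process hA hR hC
    exact ⟨h1, by omega⟩

/-- Pending blocks are nonempty, so the potential strictly decreases and the refinement terminates.
-/
theorem exists_refinesTo [Fintype α] [Fintype A.State] (hA : ∀ s, A.IsCoaccessible s)
    (hR : R.Valid) : ∃ P t, R.RefinesTo P t := by
  induction hn : R.potential using Nat.strong_induction_on generalizing R with
  | _ n ih =>
    by_cases hw : R.work = ∅
    · obtain ⟨P, W⟩ := R
      obtain rfl : W = ∅ := hw
      exact ⟨P, 0, .done P⟩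
    · obtain ⟨⟨C, a⟩, hC⟩ := Set.nonempty_iff_ne_empty.2 hw
      have h1 := potential_process hA hR hC
      have h2 : 0 < C.ncard :=
        (Set.ncard_pos (Set.toFinite _)).2 (hR.nonempty _ (hR.work_subset _ hC))
      obtain ⟨P, t, h⟩ := ih _ (by omega) (hR.process hA hC) rfl
      exact ⟨P, _, .process R C a P t hC h⟩

theorem potential_le [Fintype α] [Fintype A.State] (R : A.Refinement) :
    R.potential ≤ 2 * Fintype.card α * Fintype.card A.State *
      (Nat.log 2 (Fintype.card A.State) + 1) := by
  have h : ∀ s b, R.statePotential s b ≤ Nat.log 2 (Fintype.card A.State) + 1 := by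
    intro s b
    unfold statePotential
    have := Nat.log_mono_right (b := 2) (Set.ncard_le_card (R.block s))
    rw [Nat.card_eq_fintype_card] at this
    split_ifs <;> omega
  have h' : ∀ s b, ((A.step s b).elim 0 fun t => R.statePotential t b) ≤
      Nat.log 2 (Fintype.card A.State) + 1 := by
    intro s b
    cases A.step s b with
    | none => exact Nat.zero_le _
    | some t => exact h t b
  refine (Finset.sum_le_card_nsmul _ _ (2 * (Fintype.card A.State *
    (Nat.log 2 (Fintype.card A.State) + 1))) fun b _ => ?_).trans ?_
  · have h1 := Finset.sum_le_card_nsmul Finset.univ _ _ fun s _ => h s b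
    have h2 := Finset.sum_le_card_nsmul Finset.univ _ _ fun s _ => h' s b
    simp only [Finset.card_univ, smul_eq_mul] at h1 h2
    omega
  · simp only [Finset.card_univ, smul_eq_mul]
    exact le_of_eq (by ring)

end Refinement

end PDFA

/-! ### Reduced automata, merging, and the cost of minimization. -/

namespace PDFA

variable {α : Type}

/-- Every state is accessible and co-accessible, and no two states are equivalent. -/
structure IsReduced (A : PDFA α) : Prop where
  accessible : ∀ s, A.IsAccessible s
  coaccessible : ∀ s, A.IsCoaccessible s
  residual_injective : Function.Injective A.residual

theorem append_mem_language (A : PDFA α) {y : List α} {s : A.State}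
    (h : A.run A.start y = some s) (z : List α) : y ++ z ∈ A.language ↔ z ∈ A.residual s := by
  constructor
  · rintro ⟨q, hq, hr⟩
    obtain ⟨r, h1, h2⟩ := (run_append_eq_some _ _ _ _ _).1 hr
    rw [h] at h1
    obtain rfl := Option.some.inj h1
    exact ⟨q, hq, h2⟩
  · rintro ⟨q, hq, hr⟩
    exact ⟨q, hq, (run_append_eq_some _ _ _ _ _).2 ⟨s, h, hr⟩⟩

/-- Sending each state to the state of `B` reached by the same word is injective, since the latter
determines the residual. -/
theorem IsReduced.isMinimal {A : PDFA α} (hA : A.IsReduced) [Finite A.State] :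
    A.IsMinimal := by
  refine ⟨inferInstance, fun B hB hL => ?_⟩
  choose y hy using hA.accessible
  have h : ∀ s, ∃ q, B.run B.start (y s) = some q := by
    intro s
    obtain ⟨z, hz⟩ := hA.coaccessible s
    have h1 := (append_mem_language A (hy s) z).2 hz
    rw [← hL] at h1
    obtain ⟨q, hq, hr⟩ := h1
    obtain ⟨r, h1, -⟩ := (run_append_eq_some _ _ _ _ _).1 hr
    exact ⟨r, h1⟩
  choose e he using h
  refine Nat.card_le_card_of_injective e fun s t hst => hA.residual_injective ?_
  ext z
  rw [← append_mem_language A (hy s), ← append_mem_language A (hy t), ← hL,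
    append_mem_language B (he s), append_mem_language B (he t), hst]

section merge

variable {A : PDFA α} {P : Set (Set A.State)}

theorem sameBlock_accept (hP : (Refinement.mk P ∅ : A.Refinement).Valid) {s t : A.State}
    (h : A.sameBlock P s t) : s ∈ A.accept ↔ t ∈ A.accept := by
  obtain ⟨B, hB, hs⟩ := hP.cover s
  have ht := (h B hB).1 hs
  exact ⟨hP.accept B hB s hs t ht, hP.accept B hB t ht s hs⟩

/-- With nothing pending, the invariant `pending` leaves no room for disagreement: the partition is
a congruence. -/
theorem sameBlock_step (hP : (Refinement.mk P ∅ : A.Refinement).Valid) {s t s' : A.State} {a : α}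
    (h : A.sameBlock P s t) (hs : A.step s a = some s') :
    ∃ t', A.step t a = some t' ∧ A.sameBlock P s' t' := by
  obtain ⟨B, hB, hsB⟩ := hP.cover s
  obtain ⟨C, hC, hs'C⟩ := hP.cover s'
  have htC : t ∈ A.preimage C a := by
    by_contra htC
    rcases hP.pending B hB s hsB t ((h B hB).1 hsB) a C hC ⟨s', hs'C, hs⟩ htC with h | ⟨_, _, _, h⟩
    · exact h
    · exact h
  obtain ⟨t', ht'C, ht⟩ := htC
  refine ⟨t', ht, fun D hD => ⟨fun h => ?_, fun h => ?_⟩⟩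
  · rwa [← hP.eq_of_mem C hC D hD s' hs'C h]
  · rwa [← hP.eq_of_mem C hC D hD t' ht'C h]

theorem sameBlock_residual (hP : (Refinement.mk P ∅ : A.Refinement).Valid) {s t : A.State}
    (h : A.sameBlock P s t) : A.residual s = A.residual t := by
  ext w
  induction w generalizing s t with
  | nil => rw [nil_mem_residual, nil_mem_residual, sameBlock_accept hP h]
  | cons a w ih =>
    rw [cons_mem_residual, cons_mem_residual]
    constructor
    · rintro ⟨s', hs, hw⟩
      obtain ⟨t', ht, h'⟩ := sameBlock_step hP h hs
      exact ⟨t', ht, (ih h').1 hw⟩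
    · rintro ⟨t', ht, hw⟩
      obtain ⟨s', hs, h'⟩ := sameBlock_step hP ((A.sameBlock P).symm h) ht
      exact ⟨s', hs, (ih h').1 hw⟩

theorem sameBlock_out (s : A.State) :
    A.sameBlock P (Quotient.mk (A.sameBlock P) s).out s := Quotient.exact (Quotient.out_eq _)

theorem merge_residual (hP : (Refinement.mk P ∅ : A.Refinement).Valid) (q : (A.merge P).State) :
    (A.merge P).residual q = A.residual (Quotient.out q) := by
  ext w
  induction w generalizing q with
  | nil =>
    exact Iff.trans (b := Quotient.out q ∈ A.accept) (nil_mem_residual (A.merge P) q)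
      (nil_mem_residual A _).symm
  | cons a w ih =>
    rw [cons_mem_residual, cons_mem_residual]
    constructor
    · rintro ⟨r, hr, hw⟩
      obtain ⟨t, ht, rfl⟩ := Option.map_eq_some_iff.1 hr
      refine ⟨t, ht, ?_⟩
      rw [← sameBlock_residual hP (sameBlock_out t)]
      exact (ih _).1 hw
    · rintro ⟨t, ht, hw⟩
      refine ⟨Quotient.mk _ t, Option.map_eq_some_iff.2 ⟨t, ht, rfl⟩, (ih _).2 ?_⟩
      rwa [sameBlock_residual hP (sameBlock_out t)]

theorem merge_residual_mk (hP : (Refinement.mk P ∅ : A.Refinement).Valid) (s : A.State) :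
    (A.merge P).residual (Quotient.mk _ s) = A.residual s :=
  (merge_residual hP _).trans (sameBlock_residual hP (sameBlock_out s))

theorem merge_run (hP : (Refinement.mk P ∅ : A.Refinement).Valid) (w : List α) {s t : A.State}
    (h : A.run s w = some t) : (A.merge P).run (Quotient.mk _ s) w = some (Quotient.mk _ t) := by
  induction w generalizing s with
  | nil =>
    obtain rfl := Option.some.inj h
    rfl
  | cons a w ih =>
    obtain ⟨r, h1, h2⟩ := (run_cons _ _ _ _ _).1 h
    obtain ⟨r', h3, h4⟩ := sameBlock_step hP ((A.sameBlock P).symm (sameBlock_out s)) h1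
    refine (run_cons _ _ _ _ _).2 ⟨Quotient.mk _ r, Option.map_eq_some_iff.2 ⟨r', h3, ?_⟩, ih h2⟩
    exact Quotient.sound ((A.sameBlock P).symm h4)

/-- States with equal residuals were never separated (`nerode`), so merging the blocks leaves
distinct residuals. -/
theorem merge_isReduced (hP : (Refinement.mk P ∅ : A.Refinement).Valid)
    (hacc : ∀ s, A.IsAccessible s) (hco : ∀ s, A.IsCoaccessible s) :
    (A.merge P).IsReduced where
  accessible := by
    rintro ⟨s⟩
    obtain ⟨w, hw⟩ := hacc s
    exact ⟨w, merge_run hP w hw⟩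
  coaccessible := by
    rintro ⟨s⟩
    obtain ⟨w, hw⟩ := hco s
    exact ⟨w, (Set.ext_iff.1 (merge_residual_mk hP s) w).2 hw⟩
  residual_injective := by
    rintro ⟨s⟩ ⟨t⟩ h
    have h' : A.residual s = A.residual t :=
      (merge_residual_mk hP s).symm.trans (h.trans (merge_residual_mk hP t))
    exact Quotient.sound fun B hB => ⟨hP.nerode s t h' B hB, hP.nerode t s h'.symm B hB⟩

end merge

theorem ncard_transitions_le [Finite α] (A : PDFA α) [Finite A.State] :
    A.transitions.ncard ≤ Nat.card A.State * Nat.card α := by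
  rw [← Nat.card_prod]
  exact Set.ncard_le_card _

theorem size_le [Finite α] (A : PDFA α) [Finite A.State] :
    A.size ≤ Nat.card A.State * (Nat.card α + 1) := by
  have := A.ncard_transitions_le
  unfold size
  rw [mul_add]
  omega

theorem card_trim_le (A : PDFA α) [Finite A.State] :
    Nat.card A.trim.State ≤ Nat.card A.State :=
  Nat.card_le_card_of_injective (fun s : A.trim.State => s.1) Subtype.val_injective

theorem exists_minimizesTo [Finite α] (D : PDFA α) [Finite D.State]
    (hne : D.language.Nonempty) : ∃ M t, D.MinimizesTo M t := by
  have := Fintype.ofFinite α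
  have := Fintype.ofFinite D.trim.State
  obtain ⟨P, t, h⟩ := Refinement.exists_refinesTo (D.trim_isCoaccessible hne)
    (Refinement.initialRefinement_valid D.trim)
  exact ⟨_, _, .intro P t h⟩

theorem MinimizesTo.finite {D M : PDFA α} [Finite D.State] {t : ℕ} (h : D.MinimizesTo M t) :
    Finite M.State := by
  cases h
  infer_instance

theorem MinimizesTo.isReduced [Finite α] {D M : PDFA α} [Finite D.State] {t : ℕ}
    (h : D.MinimizesTo M t) (hacc : ∀ s, D.IsAccessible s) (hne : D.language.Nonempty) :
    M.IsReduced ∧ M.language = D.language := by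
  have := Fintype.ofFinite α
  have := Fintype.ofFinite D.trim.State
  obtain ⟨P, u, h⟩ := h
  have hP := (Refinement.RefinesTo.valid_and_le (D.trim_isCoaccessible hne) h
    (Refinement.initialRefinement_valid D.trim)).1
  refine ⟨merge_isReduced hP (D.trim_isAccessible hacc) (D.trim_isCoaccessible hne), ?_⟩
  rw [← D.trim_language]
  exact merge_residual_mk hP _

theorem MinimizesTo.le [Finite α] {D M : PDFA α} [Finite D.State] {t : ℕ}
    (h : D.MinimizesTo M t) (hne : D.language.Nonempty) :
    t ≤ 2 * (Nat.card D.State * (Nat.card α + 1)) +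
      2 * Nat.card α * Nat.card D.State * (Nat.log 2 (Nat.card D.State) + 1) := by
  have := Fintype.ofFinite α
  have := Fintype.ofFinite D.trim.State
  obtain ⟨P, u, h⟩ := h
  have h1 := (Refinement.RefinesTo.valid_and_le (D.trim_isCoaccessible hne) h
    (Refinement.initialRefinement_valid D.trim)).2.trans (Refinement.potential_le _)
  rw [← Nat.card_eq_fintype_card, ← Nat.card_eq_fintype_card] at h1
  have h2 := D.card_trim_le
  have h3 := D.size_le
  have h4 := D.trim.size_le.trans (Nat.mul_le_mul_right _ h2)
  have h5 : 2 * Nat.card α * Nat.card D.trim.State * (Nat.log 2 (Nat.card D.trim.State) + 1) ≤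
      2 * Nat.card α * Nat.card D.State * (Nat.log 2 (Nat.card D.State) + 1) := by
    gcongr
  omega

end PDFA

/-! ### The states of an automaton for `[x] = c`. -/

namespace PDFA

/-- `M` is a finite reduced automaton for the relation `[x] = c`. -/
structure Represents (M : PDFA Bool) (c : ℕ) : Prop where
  finite : Finite M.State
  isReduced : M.IsReduced
  language_eq : M.language = {x | ValidFib x ∧ fibVal x = c}

/-- The value of a word that leads to the state `s`. -/
noncomputable def stateVal (M : PDFA Bool) (s : M.State) : ℕ := by
  classical exact if h : M.IsAccessible s then fibVal h.choose else 0

namespace Represents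

variable {M : PDFA Bool} {c : ℕ}

theorem mem_residual (hM : M.Represents c) {y : List Bool} {s : M.State}
    (h : M.run M.start y = some s) (z : List Bool) :
    z ∈ M.residual s ↔ ValidFib (y ++ z) ∧ fibVal (y ++ z) = c := by
  rw [← append_mem_language M h, hM.language_eq]
  rfl

theorem exists_append (hM : M.Represents c) {y : List Bool} {s : M.State}
    (h : M.run M.start y = some s) : ∃ z ∈ M.residual s, ValidFib (y ++ z) ∧ fibVal (y ++ z) = c := by
  obtain ⟨z, hz⟩ := hM.isReduced.coaccessible s
  exact ⟨z, hz, (hM.mem_residual h z).1 hz⟩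

theorem validFib (hM : M.Represents c) {y : List Bool} {s : M.State}
    (h : M.run M.start y = some s) : ValidFib y := by
  obtain ⟨z, -, hz, -⟩ := hM.exists_append h
  exact hz.append_left

/-- A common accepted continuation `z` makes `y ++ z` and `y' ++ z` representations of `c`; they
differ by leading zeros only, and `z` cancels. -/
theorem fibVal_eq_of_run (hM : M.Represents c) {y y' : List Bool} {s : M.State}
    (h : M.run M.start y = some s) (h' : M.run M.start y' = some s) : fibVal y = fibVal y' := by
  wlog hl : y.length ≤ y'.length generalizing y y'
  · exact (this h' h (by omega)).symm
  obtain ⟨z, hz, hv, hc⟩ := hM.exists_append h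
  obtain ⟨hv', hc'⟩ := (hM.mem_residual h' z).1 hz
  have := eq_replicate_append hv hv' (by simpa using hl) (hc.trans hc'.symm)
  rw [← List.append_assoc] at this
  rw [List.append_cancel_right this, fibVal_replicate_append]

theorem stateVal_eq (hM : M.Represents c) {y : List Bool} {s : M.State}
    (h : M.run M.start y = some s) : M.stateVal s = fibVal y := by
  have hs : M.IsAccessible s := ⟨y, h⟩
  rw [stateVal, dif_pos hs]
  exact hM.fibVal_eq_of_run hs.choose_spec h

theorem stateVal_injective (hM : M.Represents c) : Function.Injective M.stateVal := by
  intro s s' h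
  obtain ⟨y, hy⟩ := hM.isReduced.accessible s
  obtain ⟨y', hy'⟩ := hM.isReduced.accessible s'
  rw [hM.stateVal_eq hy, hM.stateVal_eq hy'] at h
  apply hM.isReduced.residual_injective
  ext z
  have := validFib_append_congr (hM.validFib hy) (hM.validFib hy') h z
  rw [hM.mem_residual hy, hM.mem_residual hy', this.1, this.2]

theorem exists_take (hM : M.Represents c) {w : List Bool} (hw : ValidFib w) (hc : fibVal w = c)
    (s : M.State) : ∃ i ≤ w.length, M.stateVal s = fibVal (w.take i) := by
  obtain ⟨y, hy⟩ := hM.isReduced.accessible s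
  obtain ⟨z, -, hv, hz⟩ := hM.exists_append hy
  rw [hM.stateVal_eq hy]
  rcases le_total w.length (y ++ z).length with hl | hl
  · have h := eq_replicate_append hw hv hl (hc.trans hz.symm)
    set k := (y ++ z).length - w.length
    have h2 : y = (List.replicate k false ++ w).take y.length := by rw [← h]; simp
    -- If `y` ends inside the padding zeros, the truncated subtraction gives the empty prefix, of
    -- value 0.
    refine ⟨min (y.length - k) w.length, min_le_right _ _, ?_⟩
    rw [List.take_append, List.take_replicate, List.length_replicate] at h2
    rw [← List.take_eq_take_min]
    conv_lhs => rw [h2]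
    rw [fibVal_replicate_append]
  · have h := eq_replicate_append hv hw hl (hz.trans hc.symm)
    set k := w.length - (y ++ z).length
    refine ⟨k + y.length, by simp at hl; simp [k]; omega, ?_⟩
    rw [h, List.take_append]
    simp [List.take_replicate, fibVal_replicate_append]

theorem card_le (hM : M.Represents c) {n : ℕ} (hc : c < 2 ^ n) : Nat.card M.State ≤ 2 * n + 1 := by
  obtain ⟨w, hl, hv, hw⟩ := exists_validFib (2 * n) c (hc.trans_le (two_pow_le_fib n))
  choose i hi h using hM.exists_take hv hw
  rw [hl] at hi
  have : Function.Injective fun s => (⟨i s, Nat.lt_succ_of_le (hi s)⟩ : Fin (2 * n + 1)) := by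
    intro s t hst
    apply hM.stateVal_injective
    rw [h, h, Fin.mk.inj hst]
  simpa using Nat.card_le_card_of_injective _ this

theorem card_pos (hM : M.Represents c) : 0 < Nat.card M.State :=
  have := hM.finite
  have : Nonempty M.State := ⟨M.start⟩
  Nat.card_pos

end Represents

/-! ### Families of sets of bounded width -/

section window

variable {σ μ τ F : Type} {ι : σ → μ} {b : σ → τ} {v : μ → ℕ}
  {R : ℕ} {T : F → Set σ}

/-- The position of `p` relative to the value `m`, with its second component. -/
def windowCode (ι : σ → μ) (b : σ → τ) (v : μ → ℕ) (R m : ℕ) (p : σ) : Fin (2 * R + 1) × τ :=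
  (Fin.ofNat (2 * R + 1) (v (ι p) + R - m), b p)

/-- For values within `R` of `m`, the reduction modulo `2 * R + 1` changes nothing. -/
theorem eq_of_windowCode_eq (hinj : ∀ p p', v (ι p) = v (ι p') → b p = b p' → p = p')
    {m : ℕ} {p p' : σ} (h1 : m ≤ v (ι p) + R) (h2 : v (ι p) ≤ m + R) (h1' : m ≤ v (ι p') + R)
    (h2' : v (ι p') ≤ m + R) (h : windowCode ι b v R m p = windowCode ι b v R m p') :
    p = p' := by
  obtain ⟨h3, h4⟩ := Prod.mk_inj.1 h
  refine hinj p p' ?_ h4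
  have h5 := congrArg Fin.val h3
  simp only [Fin.ofNat] at h5
  rw [Nat.mod_eq_of_lt (by omega), Nat.mod_eq_of_lt (by omega)] at h5
  omega

/-- Each set is recovered from the first component of a chosen element, which centres the window,
and from the codes of its elements relative to this centre. -/
theorem card_le_of_window [Finite μ] [Finite τ] (hinj : ∀ p p', v (ι p) = v (ι p') → b p = b p' → p = p')
    (hT : Function.Injective T) (hne : ∀ i, (T i).Nonempty)
    (hR : ∀ i, ∀ p ∈ T i, ∀ p' ∈ T i, v (ι p) ≤ v (ι p') + R) :
    Nat.card F ≤ Nat.card μ * 2 ^ ((2 * R + 1) * Nat.card τ) := by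
  choose p hp using hne
  have : Function.Injective fun i => (ι (p i), windowCode ι b v R (v (ι (p i))) '' T i) := by
    intro i j hij
    obtain ⟨h1, h2⟩ := Prod.mk_inj.1 hij
    rw [h1] at h2
    have key : ∀ i j, ι (p i) = ι (p j) → windowCode ι b v R (v (ι (p j))) '' T i =
        windowCode ι b v R (v (ι (p j))) '' T j → T i ⊆ T j := by
      intro i j h1 h2 q hq
      have h3 : windowCode ι b v R (v (ι (p j))) q ∈
          windowCode ι b v R (v (ι (p j))) '' T j := h2 ▸ ⟨q, hq, rfl⟩
      obtain ⟨q', hq', h4⟩ := h3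
      have := eq_of_windowCode_eq hinj (hR j _ (hp j) _ hq') (hR j _ hq' _ (hp j))
        (h1 ▸ hR i _ (hp i) _ hq) (h1 ▸ hR i _ hq _ (hp i)) h4
      exact this ▸ hq'
    apply hT
    refine (key i j h1 h2).antisymm (key j i h1.symm ?_)
    rw [h1]
    exact h2.symm
  have h := Nat.card_le_card_of_injective _ this
  rw [Nat.card_prod] at h
  refine h.trans (Nat.mul_le_mul_left _ (le_of_eq ?_))
  have := Fintype.ofFinite τ
  rw [Nat.card_eq_fintype_card, Fintype.card_set, Fintype.card_prod, Fintype.card_fin,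
    Nat.card_eq_fintype_card]

/-- A traversed transition is coded by its set, the window position of its source, and an
unprojected letter; the latter determines both the projected letter and the target. -/
theorem ncard_le_of_window {β γ : Type} [Finite β] [Finite τ] [Finite F]
    (hinj : ∀ p p', v (ι p) = v (ι p') → b p = b p' → p = p')
    (hne : ∀ i, (T i).Nonempty)
    (hR : ∀ i, ∀ p ∈ T i, ∀ p' ∈ T i, v (ι p) ≤ v (ι p') + R)
    (f : β → γ) (step : σ → β → Option σ) :
    {x : F × σ × γ × σ | x.2.1 ∈ T x.1 ∧
      ∃ l, f l = x.2.2.1 ∧ step x.2.1 l = some x.2.2.2}.ncard ≤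
      Nat.card F * ((2 * R + 1) * Nat.card τ * Nat.card β) := by
  choose p hp using hne
  set Z := {x : F × σ × γ × σ | x.2.1 ∈ T x.1 ∧
      ∃ l, f l = x.2.2.1 ∧ step x.2.1 l = some x.2.2.2} with hZ
  choose l hl hs using fun x : Z => x.2.2
  have : Function.Injective fun x : Z =>
      (x.1.1, windowCode ι b v R (v (ι (p x.1.1))) x.1.2.1, l x) := by
    intro x y hxy
    simp only [Prod.mk_inj] at hxy
    obtain ⟨h1, h2, h3⟩ := hxy
    have hx := x.2.1
    rw [h1] at h2 hx
    have hy := y.2.1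
    have h4 := eq_of_windowCode_eq hinj (hR _ _ (hp _) _ hx) (hR _ _ hx _ (hp _))
      (hR _ _ (hp _) _ hy) (hR _ _ hy _ (hp _)) h2
    have h5 : x.1.2.2.1 = y.1.2.2.1 := by rw [← hl x, ← hl y, h3]
    have h6 : x.1.2.2.2 = y.1.2.2.2 := by
      have := hs x
      rw [h3, h4, hs y] at this
      exact (Option.some.inj this).symm
    exact Subtype.ext (Prod.ext h1 (Prod.ext h4 (Prod.ext h5 h6)))
  have h := Nat.card_le_card_of_injective _ this
  rwa [Nat.card_coe_set_eq, Nat.card_prod, Nat.card_prod, Nat.card_prod, Nat.card_fin] at h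

end window

section translation

variable {β : Type} {M : PDFA Bool} {c : ℕ} {B : PDFA β} {f g : β → Bool} {R : ℕ}

/-- All elements of a reachable set come from words with the same projection, so the bound for `B`
transfers to the values of states. -/
theorem stateVal_le_of_mem_determinize (hM : M.Represents c)
    (hR : ∀ v v' : List β, v.map f = v'.map f → (∃ q, B.run B.start v = some q) →
      (∃ q, B.run B.start v' = some q) → fibVal (v.map g) ≤ fibVal (v'.map g) + R)
    (T : (((M.comap g).inter B).project f).determinize.State)
    {p p' : ((M.comap g).inter B).State} (hp : p ∈ (show Set ((M.comap g).inter B).State from T.1))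
    (hp' : p' ∈ (show Set ((M.comap g).inter B).State from T.1)) :
    M.stateVal p.1.1 ≤ M.stateVal p'.1.1 + R := by
  obtain ⟨-, w, hT⟩ := determinize_state _ f T
  rw [hT] at hp hp'
  obtain ⟨v, hv, hr⟩ := hp
  obtain ⟨v', hv', hr'⟩ := hp'
  obtain ⟨h1, h2⟩ := (inter_run _ _ _ _).1 hr
  obtain ⟨h1', h2'⟩ := (inter_run _ _ _ _).1 hr'
  rw [hM.stateVal_eq ((comap_run g M _ _).symm.trans h1),
    hM.stateVal_eq ((comap_run g M _ _).symm.trans h1')]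
  exact hR v v' (hv.trans hv'.symm) ⟨_, h2⟩ ⟨_, h2'⟩

end translation

end PDFA

/-! ### The cost of one translation. -/

namespace PDFA

theorem card_inter_le {α : Type} (A B : PDFA α) [Finite A.State] [Finite B.State] :
    Nat.card (A.inter B).State ≤ Nat.card A.State * Nat.card B.State := by
  rw [← Nat.card_prod]
  exact Nat.card_le_card_of_injective (fun s : (A.inter B).State => s.1) Subtype.val_injective

section translation

variable {β : Type} {M : PDFA Bool} {c c' : ℕ} {B : PDFA β} {f g : β → Bool} {R : ℕ}

theorem mem_translation_language (hM : M.Represents c)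
    (hL : ∀ x, (∃ v : List β, v.map f = x ∧ ValidFib (v.map g) ∧ fibVal (v.map g) = c ∧
      v ∈ B.language) ↔ ValidFib x ∧ fibVal x = c') :
    (((M.comap g).inter B).project f).determinize.language
      = {x | ValidFib x ∧ fibVal x = c'} := by
  ext x
  rw [mem_determinize_language]
  refine Iff.trans ?_ (hL x)
  refine exists_congr fun v => ?_
  rw [mem_inter_language, mem_comap_language, hM.language_eq, Set.mem_ofPred_eq]
  tauto

theorem language_nonempty (c : ℕ) : {x | ValidFib x ∧ fibVal x = c}.Nonempty := by
  obtain ⟨w, -, h⟩ := exists_validFib (2 * c) c (Nat.lt_two_pow_self.trans_le (two_pow_le_fib c))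
  exact ⟨w, h⟩

/-- A translation whose second factor is a fixed automaton costs `O(n log n)`, where `n` is the
number of states of the first factor. -/
theorem translation_bound [Finite β] [Finite B.State] (hM : M.Represents c)
    (hR : ∀ v v' : List β, v.map f = v'.map f → (∃ q, B.run B.start v = some q) →
      (∃ q, B.run B.start v' = some q) → fibVal (v.map g) ≤ fibVal (v'.map g) + R)
    (hL : ∀ x, (∃ v : List β, v.map f = x ∧ ValidFib (v.map g) ∧ fibVal (v.map g) = c ∧
      v ∈ B.language) ↔ ValidFib x ∧ fibVal x = c') {q k W : ℕ} (hq : q = Nat.card B.State)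
    (hk : k = Nat.card β) (hW : W = (2 * R + 1) * q) :
    (∃ M' u, ((M.comap g).inter B).QuantifiesTo f M' u) ∧
    ∀ M' u, ((M.comap g).inter B).QuantifiesTo f M' u → M'.Represents c' ∧
      ((M.comap g).inter B).size + u ≤
        (q * (k + 1) + q * k + 2 ^ W * (W * k + 9 + 4 * (W + 1))) *
          (Nat.card M.State * (Nat.log 2 (Nat.card M.State) + 1)) := by
  have := hM.finite
  have hlang := mem_translation_language hM hL
  have hne : (((M.comap g).inter B).project f).determinize.language.Nonempty :=
    hlang ▸ language_nonempty c'
  refine ⟨?_, ?_⟩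
  · obtain ⟨M', u, h⟩ := exists_minimizesTo _ hne
    exact ⟨M', _, u, h, rfl⟩
  rintro M' _ ⟨u, h, rfl⟩
  obtain ⟨hred, hlang'⟩ := h.isReduced (accessible_isAccessible _) hne
  refine ⟨⟨h.finite, hred, hlang'.trans hlang⟩, ?_⟩
  have hmin := h.le hne
  have hsize := size_le (((M.comap g).inter B).project f).determinize
  have hinj : ∀ p p' : ((M.comap g).inter B).State, M.stateVal p.1.1 = M.stateVal p'.1.1 →
      p.1.2 = p'.1.2 → p = p' := fun p p' h1 h2 =>
    Subtype.ext (Prod.ext (hM.stateVal_injective h1) h2)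
  have hwin := fun (T : (((M.comap g).inter B).project f).determinize.State) p hp p' hp' =>
    stateVal_le_of_mem_determinize (p := p) (p' := p') hM hR T hp hp'
  have hTne := fun (T : (((M.comap g).inter B).project f).determinize.State) =>
    (determinize_state _ f T).1
  have hcard : Nat.card (((M.comap g).inter B).project f).determinize.State ≤
      Nat.card M.State * 2 ^ W := by
    rw [hW, hq]
    exact card_le_of_window (ι := fun p : ((M.comap g).inter B).State => p.1.1)
      (b := fun p => p.1.2) (v := M.stateVal) hinj Subtype.val_injective hTne hwin
  have hcost : (((M.comap g).inter B).project f).determinizeCost ≤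
      Nat.card (((M.comap g).inter B).project f).determinize.State * (W * k) +
        (((M.comap g).inter B).project f).determinize.size := by
    refine Nat.add_le_add_right ?_ _
    rw [hW, hq, hk]
    exact ncard_le_of_window (ι := fun p : ((M.comap g).inter B).State => p.1.1)
      (b := fun p => p.1.2) (v := M.stateVal) hinj hTne hwin f ((M.comap g).inter B).step
  have hA : Nat.card ((M.comap g).inter B).State ≤ Nat.card M.State * q :=
    hq ▸ card_inter_le (M.comap g) B
  have hA1 : ((M.comap g).inter B).size ≤ Nat.card M.State * q * (k + 1) :=
    (size_le _).trans (hk ▸ Nat.mul_le_mul_right _ hA)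
  have hA2 : ((M.comap g).inter B).transitions.ncard ≤ Nat.card M.State * q * k :=
    (ncard_transitions_le _).trans (hk ▸ Nat.mul_le_mul_right _ hA)
  have hn := hM.card_pos
  set n := Nat.card M.State
  set d := Nat.card (((M.comap g).inter B).project f).determinize.State
  -- `d ≤ n * 2 ^ W` adds only a constant to the logarithm.
  have hlog : Nat.log 2 d ≤ Nat.log 2 n + W := by
    refine Nat.lt_succ_iff.1 (Nat.log_lt_of_lt_pow' (Nat.succ_ne_zero _) (hcard.trans_lt ?_))
    rw [Nat.succ_eq_add_one, add_right_comm, pow_add]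
    exact Nat.mul_lt_mul_of_pos_right (Nat.lt_pow_succ_log_self one_lt_two n) (by positivity)
  have hb : Nat.card Bool = 2 := by simp
  rw [hb] at hmin hsize
  set L := Nat.log 2 n
  -- This is the refinement on a two-letter alphabet. The 9 below is 3 for writing down the subset
  -- automaton and 6 for the two traversals in the minimization.
  have h1 : 2 * 2 * d * (Nat.log 2 d + 1) ≤ 4 * d * (L + W + 1) := by
    calc _ = 4 * d * (Nat.log 2 d + 1) := by ring
      _ ≤ _ := by gcongr
  have h2 : d * (W * k + 9 + 4 * (L + W + 1)) ≤ n * 2 ^ W * (W * k + 9 + 4 * (L + W + 1)) :=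
    Nat.mul_le_mul_right _ hcard
  have h3 : n * q * (k + 1) + n * q * k + n * 2 ^ W * (W * k + 9 + 4 * (L + W + 1)) ≤
      (q * (k + 1) + q * k + 2 ^ W * (W * k + 9 + 4 * (W + 1))) * (n * (L + 1)) := by
    have e : (q * (k + 1) + q * k + 2 ^ W * (W * k + 9 + 4 * (W + 1))) * (n * (L + 1)) =
        n * q * (k + 1) + n * q * k + n * 2 ^ W * (W * k + 9 + 4 * (L + W + 1)) +
        (n * q * (k + 1) * L + n * q * k * L +
          n * 2 ^ W * (W * k * L + 9 * L + 4 * W * L)) := by ring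
    omega
  refine le_trans ?_ h3
  refine le_trans ?_ (Nat.add_le_add_left h2 _)
  have e : d * (W * k + 9 + 4 * (L + W + 1)) = d * (W * k) + 9 * d + 4 * d * (L + W + 1) := by
    ring
  rw [e]
  omega

end translation

end PDFA

/-! ### The addition automaton -/

theorem validFib_concat (x : List Bool) (b : Bool) :
    ValidFib (x ++ [b]) ↔ ValidFib x ∧ (x.getLastD false && b) = false := by
  induction x with
  | nil => simp [ValidFib]
  | cons a x ih =>
    rcases x with _ | ⟨a', x⟩
    · simp [ValidFib]
    · have h : ∀ z, ValidFib (a :: a' :: z) ↔ ¬ (a = true ∧ a' = true) ∧ ValidFib (a' :: z) :=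
        fun z => List.isChain_cons_cons
      rw [List.cons_append, List.cons_append, h, h, ← List.cons_append, ih, and_assoc]
      simp

/-- Induction from the right, as reading a letter appends it. The default `false` for the last
letter of the empty word agrees with the start state. -/
theorem adderDiff_run_iff (w : List (Bool × Bool × Bool)) (s : ℤ × ℤ × Bool × Bool × Bool) :
    adderDiff.run adderDiff.start w = some s ↔
      (ValidFib (w.map fun l => l.1) ∧ ValidFib (w.map fun l => l.2.1) ∧
        ValidFib (w.map fun l => l.2.2)) ∧
      s = ((fibVal (w.map fun l => l.1) : ℤ) + fibVal (w.map fun l => l.2.1)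
            - fibVal (w.map fun l => l.2.2),
          (fibVal ((w.map fun l => l.1) ++ [false]) : ℤ)
            + fibVal ((w.map fun l => l.2.1) ++ [false])
            - fibVal ((w.map fun l => l.2.2) ++ [false]),
          (w.map fun l => l.1).getLastD false, (w.map fun l => l.2.1).getLastD false,
          (w.map fun l => l.2.2).getLastD false) := by
  induction w using List.reverseRecOn generalizing s with
  | nil =>
    have : ValidFib [] := List.isChain_nil
    simp only [List.map_nil, this, true_and, and_self]
    exact Option.some_inj.trans eq_comm
  | append_singleton w l ih =>
    obtain ⟨a, b, e⟩ := l
    refine (PDFA.run_concat _ _ _ _ _).trans ?_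
    simp only [List.map_append, List.map_cons, List.map_nil, validFib_concat]
    set x := w.map fun l => l.1
    set y := w.map fun l => l.2.1
    set z := w.map fun l => l.2.2
    constructor
    · rintro ⟨r, hr, hs⟩
      obtain ⟨hv, rfl⟩ := (ih r).1 hr
      simp only [adderDiff] at hs
      split_ifs at hs with hc
      have hs' := Option.some.inj hs
      subst hs'
      simp only [Bool.or_eq_true, not_or, Bool.not_eq_true] at hc
      refine ⟨⟨⟨hv.1, hc.1.1⟩, ⟨hv.2.1, hc.1.2⟩, hv.2.2, hc.2⟩, ?_⟩
      simp only [List.append_assoc, List.cons_append, List.nil_append, fibVal_concat_false,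
        fibVal_concat _ a, fibVal_concat _ b, fibVal_concat _ e, List.getLastD_concat,
        Prod.mk_inj, and_true]
      push_cast
      constructor <;> ring
    · rintro ⟨⟨⟨h1, h2⟩, ⟨h3, h4⟩, h5, h6⟩, rfl⟩
      refine ⟨_, (ih _).2 ⟨⟨h1, h3, h5⟩, rfl⟩, ?_⟩
      simp only [adderDiff, h2, h4, h6]
      rw [if_neg (by simp)]
      simp only [List.append_assoc, List.cons_append, List.nil_append, fibVal_concat_false,
        fibVal_concat _ a, fibVal_concat _ b, fibVal_concat _ e, List.getLastD_concat,
        Option.some_inj, Prod.mk_inj, and_true]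
      push_cast
      constructor <;> ring

theorem mem_adder_language (w : List (Bool × Bool × Bool)) :
    w ∈ adder.language ↔
      (ValidFib (w.map fun l => l.1) ∧ ValidFib (w.map fun l => l.2.1) ∧
        ValidFib (w.map fun l => l.2.2)) ∧
      fibVal (w.map fun l => l.1) + fibVal (w.map fun l => l.2.1)
        = fibVal (w.map fun l => l.2.2) := by
  rw [adder, PDFA.trim_language, PDFA.accessible_language]
  constructor
  · rintro ⟨s, hs, hw⟩
    obtain ⟨hv, rfl⟩ := (adderDiff_run_iff w s).1 hw
    refine ⟨hv, ?_⟩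
    have h : (fibVal (w.map fun l => l.1) : ℤ) + fibVal (w.map fun l => l.2.1)
            - fibVal (w.map fun l => l.2.2) = 0 := hs
    omega
  · rintro ⟨hv, h⟩
    refine ⟨_, ?_, (adderDiff_run_iff w _).2 ⟨hv, rfl⟩⟩
    change (_ : ℤ) = 0
    simp only
    omega

theorem exists_adder_bound : ∃ R : ℕ, ∀ w, (∃ q, adder.run adder.start w = some q) →
    fibVal (w.map fun l => l.1) + fibVal (w.map fun l => l.2.1)
      ≤ fibVal (w.map fun l => l.2.2) + R ∧
    fibVal (w.map fun l => l.2.2)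
      ≤ fibVal (w.map fun l => l.1) + fibVal (w.map fun l => l.2.1) + R := by
  obtain ⟨R, hR⟩ := (Set.finite_range fun q : adder.State =>
    Int.natAbs (show ℤ × ℤ × Bool × Bool × Bool from q.1.1).1).bddAbove
  refine ⟨R, ?_⟩
  rintro w ⟨q, hq⟩
  have h1 := PDFA.run_restrict _ _ _ _ _ _ hq
  have h2 := PDFA.run_restrict _ _ _ _ _ _ h1
  have h3 := ((adderDiff_run_iff w q.1.1).1 h2).2
  have h4 := hR ⟨q, rfl⟩
  simp only [h3] at h4
  omega

theorem oneAut_run_true (u : List Bool) (s : Bool) :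
    oneAut.run true u = some s ↔ u = [] ∧ s = true := by
  cases u with
  | nil => exact Option.some_inj.trans ⟨fun h => ⟨rfl, h.symm⟩, fun h => h.2.symm⟩
  | cons b u => simp [PDFA.run, oneAut]

theorem fibVal_of_oneAut_run (u : List Bool) (s : Bool)
    (h : oneAut.run oneAut.start u = some s) : fibVal u = s.toNat := by
  induction u with
  | nil =>
    obtain rfl : false = s := Option.some.inj h
    rfl
  | cons b u ih =>
    obtain ⟨r, h1, h2⟩ := (PDFA.run_cons _ _ _ _ _).1 h
    obtain rfl : b = r := Option.some.inj h1
    cases b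
    · simpa [fibVal] using ih h2
    · obtain ⟨rfl, rfl⟩ := (oneAut_run_true _ _).1 h2
      rfl

theorem mem_oneAut_language (n : ℕ) : List.replicate n false ++ [true] ∈ oneAut.language := by
  refine ⟨true, rfl, ?_⟩
  induction n with
  | zero => rfl
  | succ n ih => exact (PDFA.run_cons _ _ _ _ _).2 ⟨false, rfl, ih⟩

instance finite_addOne : Finite addOne.State :=
  have : Finite oneAut.State := inferInstanceAs (Finite Bool)
  inferInstanceAs (Finite ((oneAut.comap fun l : Bool × Bool × Bool => l.2.1).inter adder).State)

theorem addOne_run {w : List (Bool × Bool × Bool)} (h : ∃ q, addOne.run addOne.start w = some q) :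
    fibVal (w.map fun l => l.2.1) ≤ 1 ∧ ∃ q, adder.run adder.start w = some q := by
  obtain ⟨q, hq⟩ := h
  obtain ⟨h1, h2⟩ := (PDFA.inter_run _ _ q w).1 hq
  refine ⟨?_, _, h2⟩
  have h3 := fibVal_of_oneAut_run _ _ ((PDFA.comap_run _ oneAut _ w).symm.trans h1)
  rw [h3]
  exact Bool.toNat_le _

theorem mem_addOne_language (w : List (Bool × Bool × Bool)) :
    w ∈ addOne.language ↔ (w.map fun l => l.2.1) ∈ oneAut.language ∧ w ∈ adder.language := by
  rw [addOne, PDFA.mem_inter_language, PDFA.mem_comap_language]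

/-! ### The two kinds of translations -/

theorem exists_double_bound : ∃ K : ℕ, ∀ c M, PDFA.Represents M c →
    (∃ M' u, (doubleProd M).QuantifiesTo (fun l => l.2) M' u) ∧
    ∀ M' u, (doubleProd M).QuantifiesTo (fun l => l.2) M' u → M'.Represents (2 * c) ∧
      (doubleProd M).size + u ≤
        K * (Nat.card M.State * (Nat.log 2 (Nat.card M.State) + 1)) := by
  obtain ⟨R, hR⟩ := exists_adder_bound
  -- The constant is read off by unification; it involves only the second factor, the alphabet and
  -- `R`, not `M`. Here `2[y]` varies by at most `2 * R`, hence `[y]` by at most `R`.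
  refine ⟨_, fun c M hM => PDFA.translation_bound (R := R) hM ?_ ?_ rfl rfl rfl⟩
  · rintro v v' h ⟨q, hq⟩ ⟨q', hq'⟩
    have h1 := hR _ ⟨q, (PDFA.comap_run _ adder _ v).symm.trans hq⟩
    have h2 := hR _ ⟨q', (PDFA.comap_run _ adder _ v').symm.trans hq'⟩
    simp only [List.map_map, Function.comp_def] at h1 h2
    rw [h] at h1
    omega
  · intro x
    constructor
    · rintro ⟨v, rfl, -, hc, hv⟩
      rw [PDFA.mem_comap_language, mem_adder_language] at hv
      simp only [List.map_map, Function.comp_def] at hv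
      exact ⟨hv.1.2.2, by omega⟩
    · rintro ⟨hx, hc⟩
      have hlt := fibVal_lt hx
      -- As `c ≤ [x]`, a witness of exactly the length of `x` exists, so the projection needs no
      -- extra leading zeros.
      obtain ⟨y, hl, hy, hyc⟩ := exists_validFib x.length c (by omega)
      have h1 : (y.zip x).map (fun l => l.1) = y := List.map_fst_zip hl.le
      have h2 : (y.zip x).map (fun l => l.2) = x := List.map_snd_zip hl.ge
      refine ⟨y.zip x, h2, by rwa [h1], by rwa [h1], ?_⟩
      rw [PDFA.mem_comap_language, mem_adder_language]
      simp only [List.map_map, Function.comp_def, h1, h2]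
      exact ⟨⟨hy, hy, hx⟩, by omega⟩

theorem exists_succ_bound : ∃ K : ℕ, ∀ c M, PDFA.Represents M c →
    (∃ M' u, (succProd M).QuantifiesTo (fun l => l.2.2) M' u) ∧
    ∀ M' u, (succProd M).QuantifiesTo (fun l => l.2.2) M' u → M'.Represents (c + 1) ∧
      (succProd M).size + u ≤
        K * (Nat.card M.State * (Nat.log 2 (Nat.card M.State) + 1)) := by
  obtain ⟨R, hR⟩ := exists_adder_bound
  -- `R` is lost twice in comparing through `[x]`, and 1 because on a prefix the constant track is
  -- worth 0 or 1.
  refine ⟨_, fun c M hM => PDFA.translation_bound (R := 2 * R + 1) hM ?_ ?_ rfl rfl rfl⟩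
  · intro v v' h hq hq'
    obtain ⟨h3, h1⟩ := addOne_run hq
    obtain ⟨h4, h2⟩ := addOne_run hq'
    replace h1 := hR _ h1
    replace h2 := hR _ h2
    rw [h] at h1
    omega
  · intro x
    constructor
    · rintro ⟨v, rfl, -, hc, hv⟩
      rw [mem_addOne_language, mem_adder_language] at hv
      obtain ⟨⟨s, hs, hr⟩, hv, hsum⟩ := hv
      have h1 := fibVal_of_oneAut_run _ _ hr
      obtain rfl : s = true := hs
      rw [Bool.toNat_true] at h1
      exact ⟨hv.2.2, by omega⟩
    · rintro ⟨hx, hc⟩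
      have hlt := fibVal_lt hx
      obtain ⟨y, hl, hy, hyc⟩ := exists_validFib x.length c (by omega)
      -- The constant track `0…01` has to fit into the length of `x`.
      have hx0 : x.length ≠ 0 := by
        intro h0
        rw [List.length_eq_zero_iff.1 h0] at hc
        simp [fibVal] at hc
      set u := List.replicate (x.length - 1) false ++ [true] with hu
      have hul : u.length = x.length := by simp [hu]; omega
      have huv : ValidFib u := (validFib_replicate_append _ _).2 (List.isChain_singleton _)
      have hu1 : fibVal u = 1 := fibVal_replicate_append _ _
      have h1 : (y.zip (u.zip x)).map (fun l => l.1) = y := List.map_fst_zip (by simp; omega)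
      have h0 : (y.zip (u.zip x)).map (fun l => l.2) = u.zip x :=
        List.map_snd_zip (by simp; omega)
      have h2 : (y.zip (u.zip x)).map (fun l => l.2.1) = u := by
        have : (u.zip x).map (fun l => l.1) = u := List.map_fst_zip hul.le
        conv_rhs => rw [← this, ← h0, List.map_map]
        rfl
      have h3 : (y.zip (u.zip x)).map (fun l => l.2.2) = x := by
        have : (u.zip x).map (fun l => l.2) = x := List.map_snd_zip hul.ge
        conv_rhs => rw [← this, ← h0, List.map_map]
        rfl
      refine ⟨_, h3, by rwa [h1], by rwa [h1], ?_⟩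
      rw [mem_addOne_language, mem_adder_language]
      simp only [h1, h2, h3]
      exact ⟨mem_oneAut_language _, ⟨hy, huv, hx⟩, by omega⟩

/-! ### The recursion -/

instance finite_zeroAut : Finite zeroAut.State := inferInstanceAs (Finite Unit)

theorem zeroAut_run (w : List Bool) (s : zeroAut.State) :
    zeroAut.run s w = some () ↔ ValidFib w ∧ fibVal w = 0 := by
  induction w with
  | nil => exact iff_of_true rfl ⟨List.isChain_nil, rfl⟩
  | cons b w ih =>
    cases b
    · rw [validFib_cons_false, fibVal, if_neg Bool.false_ne_true, zero_add]
      exact ih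
    · refine iff_of_false (fun h => nomatch h) fun h => ?_
      simp [fibVal] at h

theorem zeroAut_represents : zeroAut.Represents 0 where
  finite := finite_zeroAut
  isReduced :=
    { accessible := fun _ => ⟨[], rfl⟩
      coaccessible := fun s => ⟨[], s, rfl, rfl⟩
      residual_injective := fun _ _ _ => rfl }
  language_eq := by
    ext w
    refine Iff.trans ?_ (zeroAut_run w ())
    exact ⟨fun ⟨_, _, h⟩ => h, fun h => ⟨(), rfl, h⟩⟩

theorem Builds.represents {c : ℕ} {M : PDFA Bool} {t : ℕ} (h : Builds c M t) :
    M.Represents c := by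
  obtain ⟨K₁, h₁⟩ := exists_double_bound
  obtain ⟨K₂, h₂⟩ := exists_succ_bound
  induction h with
  | zero => exact zeroAut_represents
  | even c M' M t u _ hc _ hq ih =>
    have := ((h₁ _ _ ih).2 M u hq).1
    rwa [Nat.two_mul_div_two_of_even hc] at this
  | odd c M' M t u hc _ hq ih =>
    have := ((h₂ _ _ ih).2 M u hq).1
    rwa [Nat.sub_add_cancel hc.pos] at this

theorem exists_builds (c : ℕ) : ∃ M t, Builds c M t := by
  obtain ⟨K₁, h₁⟩ := exists_double_bound
  obtain ⟨K₂, h₂⟩ := exists_succ_bound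
  induction c using Nat.strong_induction_on with
  | _ c ih =>
    rcases Nat.even_or_odd c with hc | hc
    · rcases Nat.eq_zero_or_pos c with rfl | h0
      · exact ⟨_, _, .zero⟩
      · obtain ⟨M', t, h⟩ := ih (c / 2) (by omega)
        obtain ⟨M, u, hq⟩ := (h₁ _ _ h.represents).1
        exact ⟨M, _, .even c M' M t u h0 hc h hq⟩
    · obtain ⟨M', t, h⟩ := ih (c - 1) (Nat.sub_lt hc.pos one_pos)
      obtain ⟨M, u, hq⟩ := (h₂ _ _ h.represents).1
      exact ⟨M, _, .odd c M' M t u hc h hq⟩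

theorem exists_builds_bound : ∃ K : ℕ, ∀ n c M t, Builds c M t → c < 2 ^ n →
    t ≤ (2 * n + 2) * (K * ((2 * n + 1) * (Nat.log 2 (2 * n + 1) + 1) + 1)) := by
  obtain ⟨K₁, h₁⟩ := exists_double_bound
  obtain ⟨K₂, h₂⟩ := exists_succ_bound
  refine ⟨K₁ + K₂ + addOne.size + zeroAut.size, fun n c M t h hc => ?_⟩
  obtain ⟨x, hx⟩ : ∃ x, x = (2 * n + 1) * (Nat.log 2 (2 * n + 1) + 1) := ⟨_, rfl⟩
  obtain ⟨U, hU⟩ : ∃ U, U = (K₁ + K₂ + addOne.size + zeroAut.size) * (x + 1) := ⟨_, rfl⟩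
  have hU' : U = K₁ * x + K₂ * x + addOne.size * x + zeroAut.size * x + K₁ + K₂
      + addOne.size + zeroAut.size := by
    rw [hU]
    ring
  have hcard : ∀ {c M}, PDFA.Represents M c → c < 2 ^ n →
      Nat.card M.State * (Nat.log 2 (Nat.card M.State) + 1) ≤ x := by
    intro c M hM hc
    have := hM.card_le hc
    rw [hx]
    gcongr
  rw [← hx, ← hU]
  -- `2 * k + c % 2` bounds the number of translations: halving lowers `k`, and subtracting 1 clears
  -- the parity. `n` stays fixed, so `U` bounds each translation on every level; the last `U` pays
  -- for `zeroAut`.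
  suffices H : ∀ k ≤ n, c < 2 ^ k → t ≤ (2 * k + c % 2) * U + U by
    refine (H n le_rfl hc).trans ?_
    rw [← Nat.succ_mul]
    exact Nat.mul_le_mul_right _ (by omega)
  clear hc
  induction h with
  | zero =>
    intro k _ _
    have : zeroAut.size ≤ U := by omega
    omega
  | even c M' M t u h0 hc h hq ih =>
    intro k hk hck
    rcases k with _ | k
    · simp at hck
      omega
    have hc2 : c / 2 < 2 ^ k := by
      rw [pow_succ] at hck
      omega
    have h3 := ih k (by omega) hc2
    have h4 := ((h₁ _ _ h.represents).2 M u hq).2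
    have h5 := hcard h.represents (hc2.trans_le (Nat.pow_le_pow_right two_pos (by omega)))
    have h6 := h4.trans (Nat.mul_le_mul_left _ h5)
    have h7 : (2 * k + c / 2 % 2) * U ≤ (2 * k + 1) * U :=
      Nat.mul_le_mul_right _ (by omega)
    rw [Nat.even_iff.1 hc]
    have h8 : (2 * (k + 1) + 0) * U = (2 * k + 1) * U + U := by ring
    omega
  | odd c M' M t u hc h hq ih =>
    intro k hk hck
    have hc2 : c - 1 < 2 ^ k := by omega
    have h3 := ih k hk hc2
    have h4 := ((h₂ _ _ h.represents).2 M u hq).2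
    have h5 := hcard h.represents (hc2.trans_le (Nat.pow_le_pow_right two_pos hk))
    have h6 := h4.trans (Nat.mul_le_mul_left _ h5)
    have h7 : (c - 1) % 2 = 0 := by
      have := Nat.odd_iff.1 hc
      omega
    rw [h7] at h3
    rw [Nat.odd_iff.1 hc]
    have h8 : (2 * k + 1) * U = (2 * k + 0) * U + U := by ring
    omega

/-! ### The asymptotic form of the bound. -/

theorem exists_log_bound (K : ℝ) (hK : 0 ≤ K) : ∃ C : ℝ, 0 ≤ C ∧ ∀ c : ℕ, 3 ≤ c → ∀ n : ℕ,
    n = Nat.log 2 c + 1 →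
    (2 * n + 2) * (K * ((2 * n + 1) * (Nat.log 2 (2 * n + 1) + 1) + 1)) ≤
      C * Real.log c ^ 2 * Real.log (Real.log c) := by
  have hlog3 : 1 < Real.log 3 := by
    rw [Real.lt_log_iff_exp_lt (by norm_num)]
    exact Real.exp_one_lt_d9.trans (by norm_num)
  have hl0 : 0 < Real.log (Real.log 3) := Real.log_pos hlog3
  have hl7 : 0 ≤ Real.log 7 := Real.log_nonneg (by norm_num)
  set m := Real.log (Real.log 3) with hm
  -- With `l = log c`: `n ≤ 3 * l` gives `2 * n + 2 ≤ 8 * l` and `2 * n + 1 ≤ 7 * l`. Since `c ≥ 3`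
  -- forces `log l ≥ m > 0`, additive constants are absorbed by the factor `log l / m ≥ 1`.
  refine ⟨8 * (K * (7 * ((2 * Real.log 7 + 1) / m + 2) + 1 / m)), by positivity, ?_⟩
  intro c hc n hn
  have hc3 : (3 : ℝ) ≤ c := by exact_mod_cast hc
  have hlc : Real.log 3 ≤ Real.log c := Real.log_le_log (by norm_num) hc3
  set l := Real.log c
  have hl1 : 1 ≤ l := by linarith
  have hml : m ≤ Real.log l := Real.log_le_log (by linarith) hlc
  set r := Real.log l
  have hlog : ∀ a : ℕ, a ≠ 0 → (Nat.log 2 a : ℝ) ≤ 2 * Real.log a := by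
    intro a ha
    have h1 : ((2 : ℝ) ^ Nat.log 2 a) ≤ a := by exact_mod_cast Nat.pow_log_le_self 2 ha
    have h2 := Real.log_le_log (by positivity) h1
    rw [Real.log_pow] at h2
    have h3 := Real.log_two_gt_d9
    have h4 : (0 : ℝ) ≤ Nat.log 2 a := by positivity
    nlinarith
  have hn1 : (n : ℝ) ≤ 3 * l := by
    have := hlog c (by omega)
    rw [hn]
    push_cast
    linarith
  have hn2 : (Nat.log 2 (2 * n + 1) : ℝ) ≤ 2 * (Real.log 7 + r) := by
    refine (hlog _ (by omega)).trans ?_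
    rw [← Real.log_mul (by norm_num) (by linarith)]
    have : ((2 * n + 1 : ℕ) : ℝ) ≤ 7 * l := by
      push_cast
      linarith
    have := Real.log_le_log (by positivity) this
    linarith
  have hr : 1 ≤ r / m := (one_le_div hl0).2 hml
  have hr0 : 0 < r := hl0.trans_le hml
  have h1 : (Nat.log 2 (2 * n + 1) : ℝ) + 1 ≤ ((2 * Real.log 7 + 1) / m + 2) * r := by
    have e : ((2 * Real.log 7 + 1) / m + 2) * r = (2 * Real.log 7 + 1) * (r / m) + 2 * r := by
      ring
    have : 2 * Real.log 7 + 1 ≤ (2 * Real.log 7 + 1) * (r / m) :=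
      le_mul_of_one_le_right (by positivity) hr
    linarith
  have h2 : (1 : ℝ) ≤ l * (r / m) := one_le_mul_of_one_le_of_one_le hl1 hr
  calc (2 * n + 2) * (K * ((2 * n + 1) * ((Nat.log 2 (2 * n + 1) : ℝ) + 1) + 1))
      ≤ (8 * l) * (K * ((7 * l) * (((2 * Real.log 7 + 1) / m + 2) * r) + l * (r / m))) := by
        gcongr <;> linarith
    _ = _ := by ring

theorem theorem17 :
    ∃ K : ℝ, ∀ c : ℕ,
      (∃ (M : PDFA Bool) (t : ℕ), Builds c M t) ∧
      ∀ (M : PDFA Bool) (t : ℕ), Builds c M t →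
        M.language = {x | ValidFib x ∧ fibVal x = c} ∧
        M.IsMinimal ∧
        (3 ≤ c → (t : ℝ) ≤ K * Real.log c ^ 2 * Real.log (Real.log c)) ∧
        (c < 3 → (t : ℝ) ≤ K) := by
  obtain ⟨K, hK⟩ := exists_builds_bound
  obtain ⟨C, hC0, hC⟩ := exists_log_bound K (Nat.cast_nonneg _)
  -- The bound of `exists_builds_bound` at `n = 2`, which covers `c < 3`.
  set Z := (2 * 2 + 2) * (K * ((2 * 2 + 1) * (Nat.log 2 (2 * 2 + 1) + 1) + 1)) with hZ
  refine ⟨C + Z, fun c => ⟨exists_builds c, fun M t h => ?_⟩⟩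
  have hM := h.represents
  have := hM.finite
  refine ⟨hM.language_eq, hM.isReduced.isMinimal, fun hc => ?_, fun hc => ?_⟩
  · have h1 := hK _ c M t h (Nat.lt_pow_succ_log_self one_lt_two c)
    have h2 := hC c hc _ rfl
    have h3 : (t : ℝ) ≤ C * Real.log c ^ 2 * Real.log (Real.log c) :=
      le_trans (by exact_mod_cast h1) h2
    have h4 : 0 ≤ Real.log (Real.log c) := by
      apply Real.log_nonneg
      rw [Real.le_log_iff_exp_le (by positivity)]
      have : (3 : ℝ) ≤ c := by exact_mod_cast hc
      linarith [Real.exp_one_lt_d9]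
    refine h3.trans ?_
    gcongr
    exact le_add_of_nonneg_right (Nat.cast_nonneg _)
  · have h1 := hK 2 c M t h (by omega)
    have h2 : (t : ℝ) ≤ Z := by exact_mod_cast h1
    linarith
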